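/- Let $x_1,\dots,x_n$ have positive rational weights and let $f\in\mathbb{C}[x_1,\dots,x_n]$ be weighted homogeneous of degree $d>0$ with an isolated critical point at $0$. Let $M_f=\mathcal{O}_X/J_f$, where $\mathcal{O}_X=\mathbb{C}\{x\}$ and $J_f=\langle\partial_{x_1}f,\dots,\partial_{x_n}f\rangle$, be its Jacobian algebra, and let $g_1,\dots,g_\mu=1$ be weighted homogeneous polynomials of degrees $d_1\ge\dots\ge d_\mu$ whose classes form a $\mathbb{C}$-basis of $M_f$. Put $$F(x,u)=f(x)+\sum_{k=1}^\mu g_k(x)u_k,\qquad w_k=d-d_k,$$ $\mathcal{O}_S=\mathbb{C}\{u_1,\dots,u_\mu\}$ with maximal ideal $\mathfrak{m}_S$, and $\mathcal{O}_\Sigma=\mathbb{C}\{x,u\}/\langle\partial_{x_1}F,\dots,\partial_{x_n}F\rangle$, an $\mathcal{O}_S$-algebra with $\mathcal{O}_\Sigma/\mathfrak{m}_S\mathcal{O}_\Sigma=M_f$. Then $g_1,\dots,g_\mu$ is an $\mathcal{O}_S$-basis of $\mathcal{O}_\Sigma$. The Hessian determinant of $f$ is a nonzero constant multiple of $g_1$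 in $M_f$, say $c\,g_1$, and the $\mathcal{O}_S$-linear form $\mathcal{O}_\Sigma\to\mathcal{O}_S$ that sends $h$ to $c^{-1}$ times the coefficient of $g_1$ in the expansion of $h$ in the basis $g$ (the coefficient of the Hessian) generates the $\mathcal{O}_\Sigma$-module $\operatorname{Hom}_{\mathcal{O}_S}(\mathcal{O}_\Sigma,\mathcal{O}_S)$. Moreover, let $\Phi$ be this form, or any other generator of $\operatorname{Hom}_{\mathcal{O}_S}(\mathcal{O}_\Sigma,\mathcal{O}_S)$, and let $\langle a,b\rangle=\Phi(ab)$ be the corresponding (Gorenstein) pairing. There is an $\mathcal{O}_S$-basis $\check g_1,\dots,\check g_\mu$ of $\mathcal{O}_\Sigma$ with $\langle g_i,\check g_j\rangle=\delta_{ij}$, and $\Phi$ induces a $\mathbb{C}$-linear form $\Phi_0$ on $M_f$, hence a pairing $\langle a,b\rangle_0=\Phi_0(ab)$ on $M_f$. Let $\Lambda=(\lambda_{ij})$ be the matrix of multiplication by $F$ on $\mathcal{O}_\Sigma$ with respect to the basis $\check g$ in the source and $g$ in the target, and let $\bar\lambda_{ij}$ be the linear part (the homogeneous part of degree one in $u$)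 of $\lambda_{ij}\in\mathcal{O}_S$. Then $\Lambda$ is symmetric and, for all $i,j$, $$d\,\lambda_{ij}=\sum_{k=1}^\mu\langle\check g_i\check g_j,g_k\rangle\,w_ku_k,\qquad d\,\bar\lambda_{ij}=\sum_{k=1}^\mu\langle\check g_i\check g_j,g_k\rangle_0\,w_ku_k .$$ In particular, if the weights are normalized so that $d=1$, then $\lambda_{ij}=\sum_k\langle\check g_i\check g_j,g_k\rangle w_ku_k$ and $\bar\lambda_{ij}=\sum_k\langle\check g_i\check g_j,g_k\rangle_0w_ku_k$. -/

import Mathlib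

open Filter Topology

noncomputable section

namespace WHSing

/-! ### Rings of convergent power series (germs of holomorphic functions at the origin) -/

section Convergent

variable {σ τ : Type}

/-- A complex power series converges absolutely on some polydisc around the origin. -/
def Converges (p : MvPowerSeries σ ℂ) : Prop :=
  ∃ r : ℝ, 0 < r ∧ Summable fun α : σ →₀ ℕ => ‖MvPowerSeries.coeff α p‖ * r ^ α.degree

theorem Converges.smaller {p : MvPowerSeries σ ℂ} {r s : ℝ} (hs : 0 ≤ s) (hsr : s ≤ r)
    (h : Summable fun α : σ →₀ ℕ => ‖MvPowerSeries.coeff α p‖ * r ^ α.degree) :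
    Summable fun α : σ →₀ ℕ => ‖MvPowerSeries.coeff α p‖ * s ^ α.degree :=
  Summable.of_nonneg_of_le (fun _ => by positivity) (fun _ => by gcongr) h

theorem Converges.add {p q : MvPowerSeries σ ℂ} (hp : Converges p) (hq : Converges q) :
    Converges (p + q) := by
  obtain ⟨r, hr, hp⟩ := hp
  obtain ⟨s, hs, hq⟩ := hq
  have hm : 0 < min r s := lt_min hr hs
  refine ⟨min r s, hm, ?_⟩
  refine Summable.of_nonneg_of_le (fun _ => by positivity) (fun α => ?_)
    ((Converges.smaller hm.le (min_le_left r s) hp).add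
      (Converges.smaller hm.le (min_le_right r s) hq))
  rw [map_add, ← add_mul]
  gcongr
  exact norm_add_le _ _

theorem Converges.mul {p q : MvPowerSeries σ ℂ} (hp : Converges p) (hq : Converges q) :
    Converges (p * q) := by
  classical
  obtain ⟨r, hr, hp⟩ := hp
  obtain ⟨s, hs, hq⟩ := hq
  have hm : 0 < min r s := lt_min hr hs
  refine ⟨min r s, hm, ?_⟩
  set t := min r s with ht
  have hp' := Converges.smaller hm.le (min_le_left r s) hp
  have hq' := Converges.smaller hm.le (min_le_right r s) hq
  have hpq := hp'.mul_of_nonneg hq' (fun α => by positivity) (fun α => by positivity)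
  have hanti := summable_sum_mul_antidiagonal_of_summable_mul
    (f := fun α : σ →₀ ℕ => ‖MvPowerSeries.coeff α p‖ * t ^ α.degree)
    (g := fun α : σ →₀ ℕ => ‖MvPowerSeries.coeff α q‖ * t ^ α.degree) hpq
  refine Summable.of_nonneg_of_le (fun _ => by positivity) (fun α => ?_) hanti
  rw [MvPowerSeries.coeff_mul]
  calc ‖∑ x ∈ Finset.HasAntidiagonal.antidiagonal α, MvPowerSeries.coeff x.1 p * MvPowerSeries.coeff x.2 q‖
          * t ^ α.degree
      ≤ (∑ x ∈ Finset.HasAntidiagonal.antidiagonal α,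
          ‖MvPowerSeries.coeff x.1 p‖ * ‖MvPowerSeries.coeff x.2 q‖) * t ^ α.degree := by
        gcongr
        refine (norm_sum_le _ _).trans (Finset.sum_le_sum fun x _ => ?_)
        rw [norm_mul]
    _ = _ := by
        rw [Finset.sum_mul]
        refine Finset.sum_congr rfl fun x hx => ?_
        rw [← Finset.HasAntidiagonal.mem_antidiagonal.mp hx, map_add, pow_add]
        ring

theorem converges_coe (p : MvPolynomial σ ℂ) : Converges (p : MvPowerSeries σ ℂ) := by
  refine ⟨1, one_pos, summable_of_hasFiniteSupport ?_⟩
  refine p.support.finite_toSet.subset fun α hα => ?_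
  simp only [Function.mem_support, MvPolynomial.coeff_coe, one_pow, mul_one] at hα
  simpa using hα

theorem degree_embDomain (e : σ ↪ τ) (α : σ →₀ ℕ) :
    (Finsupp.embDomain e α).degree = α.degree := by
  rw [Finsupp.degree_apply, Finsupp.degree_apply, Finsupp.support_embDomain, Finset.sum_map]
  simp

theorem Converges.rename {p : MvPowerSeries σ ℂ} (hp : Converges p) (e : σ ↪ τ) :
    Converges (MvPowerSeries.rename e p) := by
  obtain ⟨r, hr, hp⟩ := hp
  refine ⟨r, hr, ?_⟩
  rw [← (Finsupp.embDomain_injective e).summable_iff]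
  · refine hp.congr fun α => ?_
    simp [degree_embDomain]
  · intro x hx
    rw [MvPowerSeries.coeff_rename_eq_zero, norm_zero, zero_mul]
    simpa [← Finsupp.embDomain_eq_mapDomain] using hx

theorem Converges.killCompl {p : MvPowerSeries τ ℂ} (hp : Converges p) (e : σ ↪ τ) :
    Converges (MvPowerSeries.killCompl e p) := by
  obtain ⟨r, hr, hp⟩ := hp
  refine ⟨r, hr, ?_⟩
  refine (hp.comp_injective (Finsupp.embDomain_injective e)).congr fun α => ?_
  simp [MvPowerSeries.coeff_killCompl, degree_embDomain]

variable (σ) in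
/-- The subalgebra of convergent power series inside the formal power series. -/
def convergentSubalgebra : Subalgebra ℂ (MvPowerSeries σ ℂ) where
  carrier := {p | Converges p}
  mul_mem' := Converges.mul
  add_mem' := Converges.add
  algebraMap_mem' c := by
    have h := converges_coe (MvPolynomial.C c : MvPolynomial σ ℂ)
    rwa [MvPolynomial.coe_C] at h

variable (σ) in
/-- `ℂ{z_s : s ∈ σ}`, the ring of germs at the origin of holomorphic functions in finitely many
variables indexed by `σ`. -/
def Conv : Type := convergentSubalgebra σ

instance : CommRing (Conv σ) := inferInstanceAs (CommRing (convergentSubalgebra σ))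

instance : Algebra ℂ (Conv σ) := inferInstanceAs (Algebra ℂ (convergentSubalgebra σ))

/-- The power series of a germ. -/
def toSeries : Conv σ →ₐ[ℂ] MvPowerSeries σ ℂ := (convergentSubalgebra σ).val

theorem toSeries_injective : Function.Injective (toSeries (σ := σ)) := Subtype.val_injective

theorem converges_toSeries (p : Conv σ) : Converges (toSeries p) := p.2

/-- Homomorphisms into convergent power series, from homomorphisms into formal power series whose
values converge. -/
def codRestrictConv {A : Type} [CommRing A] [Algebra ℂ A] (φ : A →ₐ[ℂ] MvPowerSeries σ ℂ)
    (h : ∀ a, Converges (φ a)) : A →ₐ[ℂ] Conv σ :=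
  φ.codRestrict (convergentSubalgebra σ) h

/-- The germ of a polynomial function. -/
def germ : MvPolynomial σ ℂ →ₐ[ℂ] Conv σ :=
  codRestrictConv (MvPolynomial.coeToMvPowerSeries.algHom ℂ) (fun p => by
    simpa [MvPolynomial.coeToMvPowerSeries.algHom_apply] using converges_coe p)

/-- Value at the origin. -/
def valueAtZero (p : Conv σ) : ℂ := MvPowerSeries.constantCoeff (toSeries p)

/-- The linear part of a germ: the sum of its terms of degree one. -/
def linearPart [Fintype σ] (p : Conv σ) : MvPolynomial σ ℂ :=
  ∑ k, MvPolynomial.C (MvPowerSeries.coeff (Finsupp.single k 1) (toSeries p)) * MvPolynomial.X k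

variable (σ τ) in
/-- Pull-back of germs along the projection `(x, u) ↦ u`. -/
def pullback : Conv τ →ₐ[ℂ] Conv (σ ⊕ τ) :=
  codRestrictConv ((MvPowerSeries.rename (Function.Embedding.inr : τ ↪ σ ⊕ τ)).comp toSeries)
    (fun p => (converges_toSeries p).rename _)

variable (σ τ) in
/-- Restriction of germs in `(x, u)` to `u = 0`. -/
def restrict : Conv (σ ⊕ τ) →ₐ[ℂ] Conv σ :=
  codRestrictConv ((MvPowerSeries.killCompl (Function.Embedding.inl : σ ↪ σ ⊕ τ)).comp toSeries)
    (fun p => (converges_toSeries p).killCompl _)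

theorem toSeries_germ (p : MvPolynomial σ ℂ) : toSeries (germ p) = p := rfl

theorem toSeries_pullback (p : Conv τ) : toSeries (pullback σ τ p) =
    MvPowerSeries.rename (Function.Embedding.inr : τ ↪ σ ⊕ τ) (toSeries p) := rfl

theorem toSeries_restrict (p : Conv (σ ⊕ τ)) : toSeries (restrict σ τ p) =
    MvPowerSeries.killCompl (Function.Embedding.inl : σ ↪ σ ⊕ τ) (toSeries p) := rfl

/-- Germs in `(x, u)` form an algebra over germs in `u`. -/
instance instAlgebraConv : Algebra (Conv τ) (Conv (σ ⊕ τ)) :=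
  (pullback σ τ).toRingHom.toAlgebra

end Convergent

/-! ### Singularities and their unfoldings -/

section Unfolding

variable {n μ : ℕ}

/-- The origin is an isolated critical point of `f`. -/
def HasIsolatedCriticalPoint (f : MvPolynomial (Fin n) ℂ) : Prop :=
  (∀ i, MvPolynomial.eval 0 (MvPolynomial.pderiv i f) = 0) ∧
    ∀ᶠ x in 𝓝[≠] (0 : Fin n → ℂ), ∃ i, MvPolynomial.eval x (MvPolynomial.pderiv i f) ≠ 0

/-- The Jacobian ideal `J_f` in the ring of germs at the origin. -/
def jacobianIdeal (f : MvPolynomial (Fin n) ℂ) : Ideal (Conv (Fin n)) :=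
  Ideal.span (Set.range fun i => germ (MvPolynomial.pderiv i f))

/-- The Jacobian algebra `M_f = O_X / J_f`. -/
def JacobianAlgebra (f : MvPolynomial (Fin n) ℂ) : Type :=
  Conv (Fin n) ⧸ jacobianIdeal f

instance (f : MvPolynomial (Fin n) ℂ) : CommRing (JacobianAlgebra f) :=
  inferInstanceAs (CommRing (Conv (Fin n) ⧸ jacobianIdeal f))

instance (f : MvPolynomial (Fin n) ℂ) : Algebra ℂ (JacobianAlgebra f) :=
  inferInstanceAs (Algebra ℂ (Conv (Fin n) ⧸ jacobianIdeal f))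

/-- The class in `M_f` of a polynomial. -/
def classM (f p : MvPolynomial (Fin n) ℂ) : JacobianAlgebra f :=
  Ideal.Quotient.mk (jacobianIdeal f) (germ p)

/-- The Hessian determinant of `f`. -/
def hessian (f : MvPolynomial (Fin n) ℂ) : MvPolynomial (Fin n) ℂ :=
  (Matrix.of fun i j : Fin n => MvPolynomial.pderiv i (MvPolynomial.pderiv j f)).det

/-- The unfolding `F(x, u) = f(x) + ∑ₖ gₖ(x) uₖ`. -/
def unfolding (f : MvPolynomial (Fin n) ℂ) (g : Fin μ → MvPolynomial (Fin n) ℂ) :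
    MvPolynomial (Fin n ⊕ Fin μ) ℂ :=
  MvPolynomial.rename Sum.inl f +
    ∑ k, MvPolynomial.rename Sum.inl (g k) * MvPolynomial.X (Sum.inr k)

/-- The relative Jacobian ideal of `F`, generated by its derivatives in the `x`-directions. -/
def relJacobianIdeal (f : MvPolynomial (Fin n) ℂ) (g : Fin μ → MvPolynomial (Fin n) ℂ) :
    Ideal (Conv (Fin n ⊕ Fin μ)) :=
  Ideal.span (Set.range fun i : Fin n =>
    germ (MvPolynomial.pderiv (Sum.inl i) (unfolding f g)))

/-- `O_Σ`, the ring of functions on the relative critical locus of `F`; it is an algebra over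
`O_S = ℂ{u}`. -/
def CriticalAlgebra (f : MvPolynomial (Fin n) ℂ) (g : Fin μ → MvPolynomial (Fin n) ℂ) : Type :=
  Conv (Fin n ⊕ Fin μ) ⧸ relJacobianIdeal f g

variable (f : MvPolynomial (Fin n) ℂ) (g : Fin μ → MvPolynomial (Fin n) ℂ)

instance : CommRing (CriticalAlgebra f g) :=
  inferInstanceAs (CommRing (Conv (Fin n ⊕ Fin μ) ⧸ relJacobianIdeal f g))

instance : Algebra (Conv (Fin μ)) (CriticalAlgebra f g) :=
  inferInstanceAs (Algebra (Conv (Fin μ)) (Conv (Fin n ⊕ Fin μ) ⧸ relJacobianIdeal f g))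

/-- The class in `O_Σ` of a polynomial in `(x, u)`. -/
def classSigma (p : MvPolynomial (Fin n ⊕ Fin μ) ℂ) : CriticalAlgebra f g :=
  Ideal.Quotient.mk (relJacobianIdeal f g) (germ p)

theorem restrict_germ (p : MvPolynomial (Fin n ⊕ Fin μ) ℂ) :
    restrict (Fin n) (Fin μ) (germ p) = germ (MvPolynomial.killCompl Sum.inl_injective p) := by
  suffices h : (restrict (Fin n) (Fin μ)).comp germ =
      germ.comp (MvPolynomial.killCompl (R := ℂ) Sum.inl_injective) from
    DFunLike.congr_fun h p
  refine MvPolynomial.algHom_ext fun i => ?_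
  apply toSeries_injective
  rcases i with i | k
  · have h := MvPowerSeries.killCompl_X (R := ℂ) (e := (Function.Embedding.inl :
      Fin n ↪ Fin n ⊕ Fin μ)) i
    have h2 : MvPolynomial.killCompl (R := ℂ) Sum.inl_injective
        (MvPolynomial.X (Sum.inl i : Fin n ⊕ Fin μ)) = MvPolynomial.X i := by
      have := MvPolynomial.killCompl_rename_app (R := ℂ)
        (Sum.inl_injective (α := Fin n) (β := Fin μ)) (MvPolynomial.X i)
      simpa using this
    simpa [toSeries_restrict, toSeries_germ, h2] using h
  · have h := MvPowerSeries.killCompl_X_eq_zero (R := ℂ) (e := (Function.Embedding.inl :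
      Fin n ↪ Fin n ⊕ Fin μ)) (t := Sum.inr k) (by simp)
    have h2 : MvPolynomial.killCompl (R := ℂ) Sum.inl_injective
        (MvPolynomial.X (Sum.inr k : Fin n ⊕ Fin μ)) = 0 := by
      simp [MvPolynomial.killCompl]
    simpa [toSeries_restrict, toSeries_germ, h2] using h

theorem killCompl_pderiv_unfolding (i : Fin n) :
    MvPolynomial.killCompl (Sum.inl_injective (α := Fin n) (β := Fin μ))
      (MvPolynomial.pderiv (Sum.inl i) (unfolding f g)) = MvPolynomial.pderiv i f := by
  have h0 : ∀ k : Fin μ, MvPolynomial.killCompl (R := ℂ) Sum.inl_injective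
      (MvPolynomial.X (Sum.inr k : Fin n ⊕ Fin μ)) = 0 := by
    intro k
    simp [MvPolynomial.killCompl]
  simp [unfolding, MvPolynomial.pderiv_rename Sum.inl_injective, MvPolynomial.pderiv_X, h0,
    MvPolynomial.killCompl_rename_app]

/-- The reduction `O_Σ → O_Σ / m_S O_Σ = M_f`, setting `u = 0`. -/
def reduction : CriticalAlgebra f g →+* JacobianAlgebra f :=
  Ideal.quotientMap (jacobianIdeal f) (restrict (Fin n) (Fin μ)).toRingHom (by
    rw [relJacobianIdeal, Ideal.span_le]
    rintro _ ⟨i, rfl⟩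
    change restrict (Fin n) (Fin μ) _ ∈ jacobianIdeal f
    rw [restrict_germ, killCompl_pderiv_unfolding]
    exact Ideal.subset_span ⟨i, rfl⟩)

end Unfolding

/-! ### Pairings and the matrix of multiplication by `F` -/

section Pairing

variable {R A : Type} [CommRing R] [CommRing A] [Algebra R A]

/-- `Φ` generates `Hom_R(A, R)` as an `A`-module, where `(a • Φ)(h) = Φ(a h)`. -/
def GeneratesDual (Φ : A →ₗ[R] R) : Prop :=
  ∀ φ : A →ₗ[R] R, ∃ a : A, ∀ h : A, φ h = Φ (a * h)

/-- The symmetric pairing `⟨a, b⟩ = Φ(a b)` defined by a linear form `Φ`. -/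
def pairing (Φ : A →ₗ[R] R) (a b : A) : R := Φ (a * b)

end Pairing

/-- The matrix of multiplication by `F` on `O_Σ`, with respect to the basis `g'` in the source and
the basis `b` in the target. -/
def multiplicationMatrix {n μ : ℕ} (f : MvPolynomial (Fin n) ℂ)
    (g : Fin μ → MvPolynomial (Fin n) ℂ)
    (g' b : Module.Basis (Fin μ) (Conv (Fin μ)) (CriticalAlgebra f g)) :
    Matrix (Fin μ) (Fin μ) (Conv (Fin μ)) :=
  LinearMap.toMatrix g' b (LinearMap.mulLeft (Conv (Fin μ)) (classSigma f g (unfolding f g)))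

end WHSing

end

noncomputable section

namespace WHSing

/-! ### Determinants and Koszul relations -/

section Koszul

variable {ι C : Type*} [Fintype ι] [DecidableEq ι] [CommRing C]

/-! Once `O_Σ` is known to be free over `O_S` on `g`, the matrix formula is Euler's identity.
Weighted homogeneity gives `d F = ∑ w_i x_i ∂F/∂x_i + ∑ (d - e_k) u_k g_k`, so `d F = ∑ (d - e_k)
u_k g_k` in `O_Σ` (`euler_unfolding`). If `g'` is dual to `g` under `Φ`, the coordinates of `h` in
the basis `g` are `Φ(g'_i h)`. Hence `λ_ij = Φ(g'_i g'_j F)`, which is visibly symmetric, and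
`O_S`-linearity of `Φ` gives the formula for `d λ_ij`. The linear part of `Φ(g'_i g'_j g_k) u_k`
depends only on the value of the coefficient at `u = 0`, that is, on the form induced on `M_f`.

The work lies in freeness and in the Gorenstein property. For generation, `X_i ^ (N + 1)` lies in
the ideal of the `∂f/∂x_j`, so the relative Jacobian ideal contains perturbations of these powers
that vanish at `u = 0`. Weierstrass division, a contraction argument in a weighted `ℓ¹` norm
(`exists_weierstrass_division`), shows that finitely many monomials generate `O_Σ`, and Nakayama's
lemma passes from them to `g` (`span_classSigma_eq_top`).

Independence and duality both rest on an algebraic residue (`exists_residue`). For a surjection from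
`R[x_1, ..., x_n]` whose kernel is generated by `n` elements and under which the coordinates become
nilpotent, the Bezoutian yields a linear form with dual systems `p`, `q`, such that `∑ p_s q_s` is
the Jacobian determinant. The dual systems let functionals on the special fibre lift, so
independence over `ℂ` implies independence over each Artinian base `ℂ[u]/(u)^K`, and letting `K`
grow gives it over `ℂ{u}` (`eq_zero_of_sum_pullback_mul_germ_mem`). Over `ℂ` itself the Jacobian
determinant is the Hessian, and pairing it with `h` gives the trace of multiplication by `h`. This
trace vanishes on nilpotents and is `dim M_f` at `1`, so the Hessian is a nonzero multiple of `g_1`,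
which spans the socle. A form that is nonzero on the socle is nondegenerate
(`jacobian_eq_smul_socle`). Its Gram determinant upstairs is then nonzero at the origin, hence a
unit of `O_S`. -/

/-- If every `t a` is a nonzerodivisor modulo any subfamily not containing it, then the relations
between the `t j` are generated by the Koszul relations. -/
theorem mem_span_koszul_of_sum_mul_eq_zero (t : ι → C)
    (ht : ∀ (S : Finset ι) (a : ι), a ∉ S → ∀ m : C, m * t a ∈ Ideal.span (t '' S) →
      m ∈ Ideal.span (t '' S))
    (m : ι → C) (hm : ∑ j, m j * t j = 0) :
    m ∈ Submodule.span C (Set.range fun p : ι × ι =>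
      t p.2 • (Pi.single p.1 1 : ι → C) - t p.1 • (Pi.single p.2 1 : ι → C)) := by
  set K := Submodule.span C (Set.range fun p : ι × ι =>
      t p.2 • (Pi.single p.1 1 : ι → C) - t p.1 • (Pi.single p.2 1 : ι → C)) with hK
  suffices h : ∀ S : Finset ι, ∀ m : ι → C, (∀ j, j ∉ S → m j = 0) → ∑ j ∈ S, m j * t j = 0 →
      m ∈ K from h Finset.univ m (by simp) hm
  intro S
  induction S using Finset.induction_on with
  | empty =>
    intro m h _
    have : m = 0 := funext fun j => h j (by simp)
    simp [this]
  | insert a S ha ih =>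
    intro m h hs
    rw [Finset.sum_insert ha] at hs
    -- The relation puts `m a * t a` in the ideal of the remaining `t j`, where `t a` is a
    -- nonzerodivisor modulo that ideal.
    have hmem : m a ∈ Ideal.span (t '' S) := by
      refine ht S a ha _ ?_
      rw [eq_neg_of_add_eq_zero_left hs]
      exact neg_mem (sum_mem fun j hj => Ideal.mul_mem_left _ _
        (Ideal.subset_span ⟨j, hj, rfl⟩))
    obtain ⟨k, hk⟩ : ∃ k : ι → C, ∑ j ∈ S, k j • t j = m a := by
      obtain ⟨k, hk⟩ := (Submodule.mem_span_image_finset_iff_exists_fun C).1 hmem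
      refine ⟨fun j => if h : j ∈ S then k ⟨j, h⟩ else 0, ?_⟩
      rw [← hk, ← Finset.sum_coe_sort S]
      simp
    -- Subtracting these Koszul relations cancels the coordinate `a` and leaves a relation supported
    -- on `S`.
    have key : m - ∑ j ∈ S, k j • (t j • (Pi.single a 1 : ι → C) - t a • (Pi.single j 1 : ι → C))
        ∈ K := by
      refine ih _ (fun j hj => ?_) ?_
      · by_cases hja : j = a
        · subst hja
          have : ∀ i ∈ S, k i * (t i * 1 - t j * (Pi.single i 1 : ι → C) j) = k i * t i := by
            intro i hi
            have : i ≠ j := fun h => hj (h ▸ hi)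
            rw [Pi.single_eq_of_ne this.symm]; ring
          simp only [Pi.sub_apply, Finset.sum_apply, Pi.smul_apply, smul_eq_mul, Pi.single_eq_same]
          rw [Finset.sum_congr rfl this, sub_eq_zero]
          simpa using hk.symm
        · have hS : ∀ i ∈ S, k i * (t i * (Pi.single a 1 : ι → C) j -
              t a * (Pi.single i 1 : ι → C) j) = 0 := by
            intro i hi
            have : j ≠ i := fun h => hj (h ▸ hi)
            rw [Pi.single_eq_of_ne this, Pi.single_eq_of_ne hja]; ring
          simp only [Pi.sub_apply, Finset.sum_apply, Pi.smul_apply, smul_eq_mul]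
          rw [Finset.sum_congr rfl hS, h j (by simp [hja, hj])]
          simp
      · have hS : ∀ j ∈ S, (m - ∑ i ∈ S, k i • (t i • (Pi.single a 1 : ι → C) -
            t a • (Pi.single i 1 : ι → C))) j * t j = m j * t j + t a * (k j * t j) := by
          intro j hj
          have hja : j ≠ a := fun h => ha (h ▸ hj)
          simp only [Pi.sub_apply, Finset.sum_apply, Pi.smul_apply, smul_eq_mul]
          have : ∀ i ∈ S, k i * (t i * (Pi.single a 1 : ι → C) j - t a * (Pi.single i 1 : ι → C) j)
              = if j = i then - (k i * t a) else 0 := by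
            intro i _
            rw [Pi.single_eq_of_ne hja, Pi.single_apply]
            split_ifs <;> ring
          rw [Finset.sum_congr rfl this, Finset.sum_ite_eq S j, if_pos hj]
          ring
        rw [Finset.sum_congr rfl hS, Finset.sum_add_distrib, ← Finset.mul_sum]
        simp only [smul_eq_mul] at hk
        rw [hk, ← hs]; ring
    have h2 : ∑ j ∈ S, k j • (t j • (Pi.single a 1 : ι → C) - t a • (Pi.single j 1 : ι → C)) ∈ K :=
      sum_mem fun j _ => K.smul_mem _ (Submodule.subset_span ⟨(a, j), rfl⟩)
    simpa using K.add_mem key h2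

/-- Cramer's rule. Let `N` have row `i` equal to the unit vector `e_j`. Coordinate `l` of `adj(N) N
t = det(N) t` says that `det(N) t_l` is `adj(N)_{li} t_j` plus multiples of the other entries of `M
t`, which lie in `V`. The cofactor is the same determinant with `e_l` in row `i`. -/
theorem det_updateRow_koszul_mem (M : Matrix ι ι C) (t : ι → C) (V : Ideal C) (i : ι)
    (hM : ∀ r, r ≠ i → M.mulVec t r ∈ V) (j l : ι) :
    (M.updateRow i (t l • (Pi.single j 1 : ι → C) - t j • (Pi.single l 1 : ι → C))).det ∈ V := by
  set N := M.updateRow i (Pi.single j 1 : ι → C) with hN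
  have h1 : N.det * t l = N.adjugate l i * t j +
      ∑ r ∈ Finset.univ.erase i, N.adjugate l r * M.mulVec t r := by
    have h : N.adjugate.mulVec (N.mulVec t) l = N.det * t l := by
      rw [Matrix.mulVec_mulVec, Matrix.adjugate_mul, Matrix.smul_mulVec, Matrix.one_mulVec]
      rfl
    rw [← h]
    conv_lhs => rw [Matrix.mulVec, dotProduct]
    rw [← Finset.add_sum_erase _ _ (Finset.mem_univ i)]
    congr 1
    · congr 1
      simp [hN, Matrix.mulVec]
    · refine Finset.sum_congr rfl fun r hr => ?_
      rw [hN, Matrix.mulVec, Matrix.updateRow_ne (Finset.ne_of_mem_erase hr)]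
      rfl
  have h2 : N.adjugate l i = (M.updateRow i (Pi.single l 1 : ι → C)).det := by
    rw [Matrix.adjugate_apply, hN, Matrix.updateRow_idem]
  rw [sub_eq_add_neg, Matrix.det_updateRow_add, Matrix.det_updateRow_smul, ← neg_smul,
    Matrix.det_updateRow_smul, ← hN, ← h2]
  have : t l * N.det + -t j * N.adjugate l i =
      ∑ r ∈ Finset.univ.erase i, N.adjugate l r * M.mulVec t r := by
    rw [mul_comm, h1]; ring
  rw [this]
  exact sum_mem fun r hr => Ideal.mul_mem_left _ _ (hM r (Finset.ne_of_mem_erase hr))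

/-- Two matrices with the same product with a (permutably) regular sequence `t` have the same
determinant modulo the entries of that product. -/
theorem det_sub_det_mem_of_mulVec_eq (t : ι → C)
    (ht : ∀ (S : Finset ι) (a : ι), a ∉ S → ∀ m : C, m * t a ∈ Ideal.span (t '' S) →
      m ∈ Ideal.span (t '' S))
    (M M' : Matrix ι ι C) (V : Ideal C) (hV : ∀ r, M.mulVec t r ∈ V)
    (h : M.mulVec t = M'.mulVec t) : M.det - M'.det ∈ V := by
  -- Interpolates between `M` and `M'` one row at a time. Each step changes the determinant by one
  -- whose changed row is a relation on `t`, hence a combination of Koszul rows.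
  let H : Finset ι → Matrix ι ι C := fun S => Matrix.of fun r => if r ∈ S then M' r else M r
  have hH : ∀ S r, (H S).mulVec t r = M.mulVec t r := by
    intro S r
    by_cases hr : r ∈ S
    · rw [h]; simp [H, Matrix.mulVec, hr]
    · simp [H, Matrix.mulVec, hr]
  suffices key : ∀ S, M.det - (H S).det ∈ V by
    have : H Finset.univ = M' := by ext i j; simp [H]
    simpa [this] using key Finset.univ
  intro S
  induction S using Finset.induction_on with
  | empty =>
    have : H ∅ = M := by ext i j; simp [H]
    simp [this]
  | insert i S hi ih =>
    have e1 : H S = (H S).updateRow i (M i) := by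
      ext r c
      by_cases hr : r = i
      · subst hr; simp [H, hi]
      · simp [hr]
    have e2 : H (insert i S) = (H S).updateRow i (M' i) := by
      ext r c
      by_cases hr : r = i
      · subst hr; simp [H]
      · simp [H, hr]
    have e3 : (H S).det - (H (insert i S)).det = ((H S).updateRow i (M i - M' i)).det := by
      rw [sub_eq_add_neg (M i), Matrix.det_updateRow_add, ← neg_one_smul C (M' i),
        Matrix.det_updateRow_smul, ← e1, ← e2]
      ring
    have hrel : ∑ j, (M i - M' i) j * t j = 0 := by
      have := congrFun h i
      simp only [Matrix.mulVec, dotProduct] at this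
      simp only [Pi.sub_apply, sub_mul, Finset.sum_sub_distrib, this, sub_self]
    have hmem := mem_span_koszul_of_sum_mul_eq_zero t ht _ hrel
    have : ((H S).updateRow i (M i - M' i)).det ∈ V := by
      generalize M i - M' i = x at hmem
      induction hmem using Submodule.span_induction with
      | mem x hx =>
        obtain ⟨⟨j, l⟩, rfl⟩ := hx
        exact det_updateRow_koszul_mem _ t V i (fun r _ => by rw [hH]; exact hV r) j l
      | zero =>
        have : ((H S).updateRow i 0).det = 0 := Matrix.det_eq_zero_of_row_eq_zero i (by simp)
        rw [this]; exact V.zero_mem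
      | add x y _ _ hx hy => rw [Matrix.det_updateRow_add]; exact V.add_mem hx hy
      | smul a x _ hx => rw [Matrix.det_updateRow_smul]; exact V.mul_mem_left _ hx
    have := V.add_mem ih (e3 ▸ this)
    simpa using this

end Koszul

section PointIdeal

variable {ι A : Type*} [CommRing A]

/-- Membership in a monomial ideal is tested on exponents, and raising the exponent of `X a` does
not affect divisibility by `X i` for `i ≠ a`. -/
theorem mem_span_X_image_of_mul_X_mem (S : Finset ι) (a : ι) (ha : a ∉ S) (m : MvPolynomial ι A)
    (h : m * MvPolynomial.X a ∈ Ideal.span ((MvPolynomial.X : ι → MvPolynomial ι A) '' S)) :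
    m ∈ Ideal.span ((MvPolynomial.X : ι → MvPolynomial ι A) '' S) := by
  classical
  rw [MvPolynomial.mem_ideal_span_X_image] at h ⊢
  intro α hα
  obtain ⟨i, hi, h'⟩ := h (α + Finsupp.single a 1) (by
    rw [MvPolynomial.mem_support_iff, MvPolynomial.coeff_mul_X]
    exact MvPolynomial.mem_support_iff.1 hα)
  refine ⟨i, hi, ?_⟩
  have : a ≠ i := fun h => ha (h ▸ hi)
  simpa [Finsupp.single_apply, this] using h'

/-- Translation of the variables of a polynomial ring. -/
def translate (y : ι → A) : MvPolynomial ι A ≃ₐ[A] MvPolynomial ι A :=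
  AlgEquiv.ofAlgHom (MvPolynomial.aeval fun j => MvPolynomial.X j - MvPolynomial.C (y j))
    (MvPolynomial.aeval fun j => MvPolynomial.X j + MvPolynomial.C (y j))
    (MvPolynomial.algHom_ext fun j => by
      simp [← MvPolynomial.algebraMap_eq])
    (MvPolynomial.algHom_ext fun j => by
      simp [← MvPolynomial.algebraMap_eq])

theorem translate_X (y : ι → A) (j : ι) :
    translate y (MvPolynomial.X j) = MvPolynomial.X j - MvPolynomial.C (y j) := by
  simp [translate]

theorem mem_span_X_sub_C_image_of_mul_mem (y : ι → A) (S : Finset ι) (a : ι) (ha : a ∉ S)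
    (m : MvPolynomial ι A)
    (h : m * (MvPolynomial.X a - MvPolynomial.C (y a)) ∈
      Ideal.span ((fun j => MvPolynomial.X j - MvPolynomial.C (y j)) '' (S : Set ι))) :
    m ∈ Ideal.span ((fun j => MvPolynomial.X j - MvPolynomial.C (y j)) '' (S : Set ι)) := by
  have e : Ideal.span ((fun j => MvPolynomial.X j - MvPolynomial.C (y j)) '' (S : Set ι)) =
      (Ideal.span ((MvPolynomial.X : ι → MvPolynomial ι A) '' S)).map
        (translate y : MvPolynomial ι A ≃+* MvPolynomial ι A) := by
    rw [Ideal.map_span, ← Set.image_comp]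
    congr 1
    exact Set.image_congr fun j _ => (translate_X y j).symm
  obtain ⟨m, rfl⟩ := (translate y).surjective m
  rw [e] at h ⊢
  have hin : ∀ q, (translate y) q ∈ (Ideal.span ((MvPolynomial.X : ι → MvPolynomial ι A) '' S)).map
      (translate y : MvPolynomial ι A ≃+* MvPolynomial ι A) ↔
      q ∈ Ideal.span ((MvPolynomial.X : ι → MvPolynomial ι A) '' S) := by
    intro q
    exact Ideal.apply_mem_of_equiv_iff (f := (translate y : MvPolynomial ι A ≃+* MvPolynomial ι A))
  rw [← translate_X, ← map_mul, hin] at h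
  exact (hin _).2 (mem_span_X_image_of_mul_X_mem S a ha m h)

/-- Modulo the ideal each variable equals the constant `y j`, so every polynomial equals its value
at `y`. -/
theorem sub_C_eval_mem_span (y : ι → A) (p : MvPolynomial ι A) :
    p - MvPolynomial.C (MvPolynomial.eval y p) ∈
      Ideal.span (Set.range fun j => MvPolynomial.X j - MvPolynomial.C (y j)) := by
  set I := Ideal.span (Set.range fun j => MvPolynomial.X j - MvPolynomial.C (y j)) with hI
  rw [← Ideal.Quotient.eq]
  have : (Ideal.Quotient.mkₐ A I) = ((Ideal.Quotient.mkₐ A I).comp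
      (Algebra.ofId A (MvPolynomial ι A))).comp (MvPolynomial.aeval y) := by
    refine MvPolynomial.algHom_ext fun j => ?_
    simp only [AlgHom.comp_apply, MvPolynomial.aeval_X]
    exact Ideal.Quotient.eq.2 (Ideal.subset_span ⟨j, rfl⟩)
  exact DFunLike.congr_fun this p

end PointIdeal

/-! ### The residue form of a complete intersection that is finite over the base ring -/

section Residue

variable {ι R : Type*} [CommRing R]

variable [Fintype ι]

theorem coeff_eq_zero_of_mem_span_X_pow {A : Type*} [CommRing A] (N : ℕ)
    {q : MvPolynomial ι A}
    (hq : q ∈ Ideal.span (Set.range fun i : ι => (MvPolynomial.X i : MvPolynomial ι A) ^ (N + 1))) :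
    MvPolynomial.coeff (Finsupp.equivFunOnFinite.symm fun _ => N) q = 0 := by
  obtain ⟨c, rfl⟩ := (Ideal.mem_span_range_iff_exists_fun).1 hq
  rw [MvPolynomial.coeff_sum]
  refine Finset.sum_eq_zero fun i _ => ?_
  rw [MvPolynomial.X_pow_eq_monomial, MvPolynomial.coeff_mul_monomial', if_neg]
  intro h
  have := h i
  simp at this

variable [DecidableEq ι]

/-- The product is the Bezoutian of the pure powers `X_i ^ (N + 1)`; this normalizes the residue so
that it reproduces elements exactly. -/
theorem coeff_prod_geom_sum {A : Type*} [CommRing A] (N : ℕ) (y : ι → A) :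
    MvPolynomial.coeff (Finsupp.equivFunOnFinite.symm fun _ => N)
      (∏ i : ι, ∑ k ∈ Finset.range (N + 1),
        (MvPolynomial.X i : MvPolynomial ι A) ^ k * MvPolynomial.C (y i) ^ (N - k)) = 1 := by
  rw [Finset.prod_univ_sum, MvPolynomial.coeff_sum]
  have h : ∀ k : ι → ℕ, ∏ i, (MvPolynomial.X i : MvPolynomial ι A) ^ (k i) *
      MvPolynomial.C (y i) ^ (N - k i) = MvPolynomial.monomial (Finsupp.equivFunOnFinite.symm k)
        (∏ i, y i ^ (N - k i)) := by
    intro k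
    rw [Finset.prod_mul_distrib, MvPolynomial.monomial_eq, mul_comm, map_prod]
    simp [Finsupp.prod_fintype]
  rw [Finset.sum_eq_single (fun _ => N)]
  · rw [h]; simp
  · intro k _ hk
    rw [h, MvPolynomial.coeff_monomial, if_neg]
    exact fun h => hk (Finsupp.equivFunOnFinite.symm.injective h)
  · intro h
    simp at h

/-- The Bezoutian `D` of `F` reproduces elements through the residue of monomials. -/
theorem exists_bezoutian {A : Type*} [CommRing A] [Algebra R A] (π : MvPolynomial ι R →ₐ[R] A)
    (F : ι → MvPolynomial ι R) (hF : ∀ i, π (F i) = 0) (N : ℕ)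
    (a : Matrix ι ι (MvPolynomial ι R))
    (ha : a.mulVec F = fun i => MvPolynomial.X i ^ (N + 1)) :
    ∃ D : MvPolynomial ι A,
      (∀ h, MvPolynomial.coeff (Finsupp.equivFunOnFinite.symm fun _ => N)
        (MvPolynomial.map (algebraMap R A) (h * a.det) * D) = π h) ∧
      MvPolynomial.eval (fun i => π (MvPolynomial.X i)) D =
        π (Matrix.of fun i j => MvPolynomial.pderiv i (F j)).det := by
  let y : ι → A := fun i => π (MvPolynomial.X i)
  let ξ : MvPolynomial ι R →+* MvPolynomial ι A := MvPolynomial.map (algebraMap R A)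
  let top : ι →₀ ℕ := Finsupp.equivFunOnFinite.symm fun _ => N
  let t : ι → MvPolynomial ι A := fun j => MvPolynomial.X j - MvPolynomial.C (y j)
  have hξ : ∀ p, MvPolynomial.eval y (ξ p) = π p := by
    intro p
    rw [MvPolynomial.eval_map]
    exact DFunLike.congr_fun (MvPolynomial.aeval_unique π).symm p
  -- Over `A` the polynomial `F i` vanishes at the tautological point `y`, so it is a combination of
  -- the `X_j - y_j`. The determinant of the coefficients is the Bezoutian.
  have hd : ∀ i, ∃ d : ι → MvPolynomial ι A, ∑ j, d j * t j = ξ (F i) := by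
    intro i
    refine (Ideal.mem_span_range_iff_exists_fun).1 ?_
    have h := sub_C_eval_mem_span y (ξ (F i))
    rwa [hξ, hF, map_zero, sub_zero] at h
  choose d hd using hd
  let d' : Matrix ι ι (MvPolynomial ι A) := Matrix.of d
  let e : ι → MvPolynomial ι A := fun i => ∑ k ∈ Finset.range (N + 1),
        (MvPolynomial.X i : MvPolynomial ι A) ^ k * MvPolynomial.C (y i) ^ (N - k)
  -- Factorization of `X_i ^ (N + 1) - y_i ^ (N + 1)`, whose second term is zero in `A`.
  have he : ∀ i, e i * t i = MvPolynomial.X i ^ (N + 1) := by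
    intro i
    have h := geom_sum₂_mul (MvPolynomial.X i : MvPolynomial ι A) (MvPolynomial.C (y i)) (N + 1)
    rw [Nat.add_sub_cancel] at h
    have h0 : y i ^ (N + 1) = 0 := by
      change π (MvPolynomial.X i) ^ (N + 1) = 0
      rw [← map_pow, ← congrFun ha i]
      simp [Matrix.mulVec, dotProduct, hF]
    rw [← map_pow MvPolynomial.C, h0, map_zero, sub_zero] at h
    exact h
  set V : Ideal (MvPolynomial ι A) :=
    Ideal.span (Set.range fun i : ι => (MvPolynomial.X i : MvPolynomial ι A) ^ (N + 1)) with hV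
  have hM : ∀ r, (Matrix.diagonal e).mulVec t r = MvPolynomial.X r ^ (N + 1) := by
    intro r
    rw [Matrix.mulVec_diagonal, he]
  have hM' : ∀ r, (a.map ξ * d').mulVec t r = MvPolynomial.X r ^ (N + 1) := by
    intro r
    have h1 : d'.mulVec t = fun i => ξ (F i) := funext fun i => hd i
    rw [← Matrix.mulVec_mulVec, h1]
    have := congrArg ξ (congrFun ha r)
    simp only [Matrix.mulVec, dotProduct, map_sum, map_pow, map_mul, ξ, MvPolynomial.map_X] at this
    rw [← this]
    rfl
  -- Both `diagonal e` and `a * d` send `t` to the vector of pure powers, so their determinants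
  -- agree modulo those powers. This is the transformation law for residues.
  have hdet := det_sub_det_mem_of_mulVec_eq t (mem_span_X_sub_C_image_of_mul_mem y)
    (Matrix.diagonal e) (a.map ξ * d') V
    (fun r => by rw [hM]; exact Ideal.subset_span ⟨r, rfl⟩) (funext fun r => by rw [hM, hM'])
  -- `ξ h - π h` vanishes at `y`, so it is a combination of the `t j`; each `t j` times `∏ e i`
  -- contains the factor `t j * e j = X j ^ (N + 1)`.
  have hshift : ∀ h : MvPolynomial ι R,
      (ξ h - MvPolynomial.C (π h)) * (Matrix.diagonal e).det ∈ V := by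
    intro h
    have h1 := sub_C_eval_mem_span y (ξ h)
    rw [hξ] at h1
    obtain ⟨c, hc⟩ := (Ideal.mem_span_range_iff_exists_fun).1 h1
    rw [← hc, Finset.sum_mul]
    refine sum_mem fun j _ => ?_
    rw [mul_assoc]
    refine V.mul_mem_left _ ?_
    rw [Matrix.det_diagonal, ← Finset.mul_prod_erase _ _ (Finset.mem_univ j), ← mul_assoc]
    refine V.mul_mem_right _ ?_
    change t j * e j ∈ V
    rw [mul_comm, he]
    exact Ideal.subset_span ⟨j, rfl⟩
  have hrep : ∀ h : MvPolynomial ι R,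
      MvPolynomial.coeff top (ξ (h * a.det) * d'.det) = π h := by
    intro h
    have h1 := V.mul_mem_left (ξ h) hdet
    have h2 := coeff_eq_zero_of_mem_span_X_pow N (V.sub_mem (hshift h) h1)
    have h3 : (ξ h - MvPolynomial.C (π h)) * (Matrix.diagonal e).det -
        ξ h * ((Matrix.diagonal e).det - (a.map ξ * d').det) =
        ξ (h * a.det) * d'.det - MvPolynomial.C (π h) *
          (Matrix.diagonal e).det := by
      rw [Matrix.det_mul, map_mul, RingHom.map_det]
      simp only [RingHom.mapMatrix_apply]
      ring
    rw [h3, MvPolynomial.coeff_sub, MvPolynomial.coeff_C_mul, Matrix.det_diagonal,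
      coeff_prod_geom_sum, mul_one, sub_eq_zero] at h2
    exact h2
  refine ⟨d'.det, hrep, ?_⟩
  -- Differentiate `F i = ∑ d i j * t j` and evaluate at `y`, where every `t j` vanishes: on the
  -- diagonal the Bezoutian matrix becomes the Jacobian matrix.
  have h2 : ∀ i j, MvPolynomial.eval y (d i j) =
      π (MvPolynomial.pderiv j (F i)) := by
    intro i j
    have h3 := congrArg (MvPolynomial.pderiv j) (hd i)
    have h4 := congrArg (MvPolynomial.eval y) h3
    rw [MvPolynomial.pderiv_map, hξ] at h4
    rw [← h4, map_sum, map_sum]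
    simp [t, MvPolynomial.pderiv_X, Pi.single_apply, Derivation.leibniz, apply_ite]
  rw [RingHom.map_det, AlgHom.map_det, ← Matrix.det_transpose]
  congr 1
  ext i j
  exact h2 j i


/-- If a finite algebra with nilpotent coordinates is defined by `n` equations `F i` in `n`
variables, then it carries a linear form `φ` (the residue) that has dual systems `p`, `q` of
generators, with `∑ p k * q k` equal to the Jacobian determinant. -/
theorem exists_residue {A : Type*} [CommRing A] [Algebra R A] (π : MvPolynomial ι R →ₐ[R] A)
    (hπ : Function.Surjective π) (F : ι → MvPolynomial ι R)
    (hker : ∀ p, π p = 0 ↔ p ∈ Ideal.span (Set.range F)) (N : ℕ)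
    (hN : ∀ i, π (MvPolynomial.X i) ^ (N + 1) = 0) :
    ∃ (φ : A →ₗ[R] R) (s : Finset (ι →₀ ℕ)) (p q : s → A), (∀ h, ∑ k, φ (h * p k) • q k = h) ∧
      ∑ k, p k * q k = π (Matrix.of fun i j => MvPolynomial.pderiv i (F j)).det := by
  choose a ha using fun i => (Ideal.mem_span_range_iff_exists_fun).1
    ((hker _).1 ((map_pow π _ _).trans (hN i)))
  let a' : Matrix ι ι (MvPolynomial ι R) := Matrix.of a
  let top : ι →₀ ℕ := Finsupp.equivFunOnFinite.symm fun _ => N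
  -- The residue of `h` with respect to `F` is the residue of `h * det a` with respect to the pure
  -- powers, namely the coefficient of the exponent `(N, ..., N)`.
  let φ₀ : MvPolynomial ι R →ₗ[R] R :=
    (MvPolynomial.lcoeff R top).comp (LinearMap.mulRight R a'.det)
  have hφ₀ : LinearMap.ker π.toLinearMap ≤ LinearMap.ker φ₀ := by
    intro h hh
    obtain ⟨c, rfl⟩ := (Ideal.mem_span_range_iff_exists_fun).1 ((hker _).1 hh)
    rw [LinearMap.mem_ker]
    change MvPolynomial.coeff top ((∑ i, c i * F i) * a'.det) = 0
    refine coeff_eq_zero_of_mem_span_X_pow N ?_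
    rw [Finset.sum_mul]
    refine sum_mem fun i _ => ?_
    have h1 : a'.mulVec F = fun r => MvPolynomial.X r ^ (N + 1) := funext fun r => ha r
    -- Cramer's rule puts `F i * det a` in the ideal of the pure powers, whose elements have no
    -- coefficient at the top exponent.
    have h2 : F i * a'.det = ∑ r, a'.adjugate i r * MvPolynomial.X r ^ (N + 1) := by
      have h3 := congrFun (congrArg a'.adjugate.mulVec h1) i
      rw [Matrix.mulVec_mulVec, Matrix.adjugate_mul, Matrix.smul_mulVec, Matrix.one_mulVec] at h3
      rw [mul_comm]
      exact h3
    rw [mul_assoc, h2]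
    exact Ideal.mul_mem_left _ _ (sum_mem fun r _ =>
      Ideal.mul_mem_left _ _ (Ideal.subset_span ⟨r, rfl⟩))
  let φ : A →ₗ[R] R := ((LinearMap.ker π.toLinearMap).liftQ φ₀ hφ₀).comp
    (π.toLinearMap.quotKerEquivOfSurjective hπ).symm.toLinearMap
  have hφ : ∀ h : MvPolynomial ι R, φ (π h) = MvPolynomial.coeff top (h * a'.det) := by
    intro h
    have : (π.toLinearMap.quotKerEquivOfSurjective hπ).symm (π h) =
        (LinearMap.ker π.toLinearMap).mkQ h := by
      rw [LinearEquiv.symm_apply_eq]; rfl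
    change ((LinearMap.ker π.toLinearMap).liftQ φ₀ hφ₀)
      ((π.toLinearMap.quotKerEquivOfSurjective hπ).symm (π h)) = _
    rw [this]
    rfl
  obtain ⟨D, hD, hJ⟩ := exists_bezoutian π F
    (fun i => (hker _).2 (Ideal.subset_span ⟨i, rfl⟩)) N a' (funext ha)
  -- Write `D = ∑ D_k X^k`. The systems are the classes of the monomials and the coefficients `D_k`;
  -- evaluating `D` at `y` gives `∑ p_k q_k`.
  refine ⟨φ, D.support, fun k => π (MvPolynomial.monomial k 1),
    fun k => MvPolynomial.coeff k D, fun h => ?_, ?_⟩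
  · obtain ⟨h, rfl⟩ := hπ h
    conv_rhs => rw [← hD h, MvPolynomial.as_sum D, Finset.mul_sum, MvPolynomial.coeff_sum]
    rw [← Finset.sum_coe_sort D.support]
    refine Finset.sum_congr rfl fun k _ => ?_
    rw [← map_mul, hφ]
    dsimp only
    generalize MvPolynomial.coeff (k : ι →₀ ℕ) D = c
    have e1 : MvPolynomial.map (algebraMap R A) (h * a'.det) * MvPolynomial.monomial k c =
        MvPolynomial.C c * MvPolynomial.map (algebraMap R A)
          (h * MvPolynomial.monomial k 1 * a'.det) := by
      have : (MvPolynomial.monomial k c : MvPolynomial ι A) =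
          MvPolynomial.C c * MvPolynomial.map (algebraMap R A) (MvPolynomial.monomial k 1) := by
        rw [MvPolynomial.map_monomial, MvPolynomial.C_mul_monomial, map_one, mul_one]
      rw [this, map_mul, map_mul, map_mul]; ring
    rw [Algebra.smul_def, e1, MvPolynomial.coeff_C_mul, MvPolynomial.coeff_map, mul_comm]
  · rw [← hJ]
    conv_rhs => rw [MvPolynomial.as_sum D, map_sum, ← Finset.sum_coe_sort D.support]
    refine Finset.sum_congr rfl fun k _ => ?_
    dsimp only
    rw [mul_comm, MvPolynomial.eval_monomial]
    congr 1
    rw [MvPolynomial.monomial_eq, map_one, one_mul, Finsupp.prod, Finsupp.prod, map_prod]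
    simp only [map_pow]

end Residue

/-! ### Consequences of the existence of dual systems of generators -/

section DualSystem

/-- The dual systems make `A` projective over `R`, so the functionals on `M` dual to the images of
the `g i` lift to `R`-linear functionals on `A`. These form with `g` a matrix congruent to the
identity modulo the nilpotent ideal `ker ε`, and such a matrix has no kernel. -/
theorem linearIndependent_of_residue {k R A M κ ι : Type*} [Fintype κ] [Fintype ι] [Field k]
    [CommRing R] [Algebra k R] [CommRing A] [Algebra R A] [CommRing M] [Algebra k M]
    (ε : R →ₐ[k] k) (K : ℕ) (hK : (RingHom.ker ε) ^ K = ⊥) (ρ : A →+* M)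
    (hρ : ∀ r, ρ (algebraMap R A r) = algebraMap k M (ε r))
    (φ : A →ₗ[R] R) (p q : κ → A) (hpq : ∀ h, ∑ s, φ (h * p s) • q s = h)
    (g : ι → A) (hg : LinearIndependent k fun i => ρ (g i)) : LinearIndependent R g := by
  classical
  obtain ⟨L, hL⟩ := LinearMap.exists_leftInverse_of_injective _ (LinearMap.ker_eq_bot.2 hg)
  have hLg : ∀ i, L (ρ (g i)) = Finsupp.single i 1 := by
    intro i
    have := LinearMap.congr_fun hL (Finsupp.single i 1)
    simpa using this
  rw [Fintype.linearIndependent_iff]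
  intro c hc
  let G : ι → ι → R := fun j i => ∑ s, algebraMap k R (L (ρ (q s)) j) * φ (g i * p s)
  have hG : ∀ j i, ε (G j i) = (Finsupp.single i (1 : k)) j := by
    intro j i
    rw [← hLg]
    conv_rhs => rw [← hpq (g i)]
    simp only [G, map_sum, Finsupp.coe_finsetSum, Finset.sum_apply]
    refine Finset.sum_congr rfl fun s _ => ?_
    rw [Algebra.smul_def, map_mul ε, map_mul ρ, AlgHom.commutes, hρ,
      ← Algebra.smul_def (ε _) (ρ (q s)), map_smul, Finsupp.smul_apply, smul_eq_mul, mul_comm]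
    rfl
  have hcG : ∀ j, ∑ i, c i * G j i = 0 := by
    intro j
    simp only [G, Finset.mul_sum]
    rw [Finset.sum_comm]
    refine Finset.sum_eq_zero fun s _ => ?_
    have h := congrArg (fun x => φ (x * p s)) hc
    simp only [Finset.sum_mul, map_sum, smul_mul_assoc, map_smul, zero_mul, map_zero,
      smul_eq_mul] at h
    rw [← mul_zero (algebraMap k R (L (ρ (q s)) j)), ← h, Finset.mul_sum]
    exact Finset.sum_congr rfl fun i _ => by ring
  have hmem : ∀ t : ℕ, ∀ j, c j ∈ (RingHom.ker ε) ^ t := by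
    intro t
    induction t with
    | zero => simp
    | succ t ih =>
      intro j
      -- Since `∑ c i * G j i = 0`, each `c j` is a combination of the `c i` with coefficients in
      -- `ker ε`, so it gains one power of that ideal.
      have : c j = ∑ i, c i * (algebraMap k R (Finsupp.single i (1 : k) j) - G j i) := by
        simp only [mul_sub, Finset.sum_sub_distrib, hcG, sub_zero]
        rw [Finset.sum_eq_single j]
        · simp
        · intro i _ hi
          simp [hi]
        · simp
      rw [this, pow_succ]
      refine sum_mem fun i _ => Ideal.mul_mem_mul (ih i) ?_
      rw [RingHom.mem_ker, map_sub, hG, AlgHom.commutes]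
      simp
  intro i
  have := hmem K i
  rwa [hK, Ideal.mem_bot] at this

variable {k M κ : Type*} [Fintype κ] [Field k] [CommRing M] [Algebra k M]
  [FiniteDimensional k M]

/-- Multiplication by `h` is the sum of the rank one maps `v ↦ φ(h p_s v) q_s`, whose traces are
`φ(h p_s q_s)`. -/
theorem trace_eq_residue_mul_jacobian (φ : M →ₗ[k] k) (p q : κ → M)
    (hpq : ∀ h, ∑ s, φ (h * p s) • q s = h) (h : M) :
    Algebra.trace k M h = φ (h * ∑ s, p s * q s) := by
  have : Algebra.lmul k M h = ∑ s, (φ.comp (LinearMap.mulLeft k (h * p s))).smulRight (q s) := by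
    ext v
    simp only [LinearMap.coe_sum, Finset.sum_apply, LinearMap.smulRight_apply,
      LinearMap.comp_apply, LinearMap.mulLeft_apply]
    change h * v = _
    conv_lhs => rw [← hpq (h * v)]
    exact Finset.sum_congr rfl fun s _ => by rw [mul_right_comm]
  rw [Algebra.trace_apply]
  change LinearMap.trace k M (Algebra.lmul k M h) = _
  rw [this, map_sum, Finset.mul_sum, map_sum]
  refine Finset.sum_congr rfl fun s _ => ?_
  rw [LinearMap.trace_smulRight]
  simp

variable [CharZero k] [Nontrivial M]

/-- By the trace formula `φ(h J)` vanishes for nilpotent `h` and `φ(J) = dim M`, which is nonzero in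
characteristic zero. A multiple of `g₀` defines the same functional, and `φ` is nondegenerate, so
the two elements coincide. -/
theorem jacobian_eq_smul_socle (φ : M →ₗ[k] k) (p q : κ → M)
    (hpq : ∀ h, ∑ s, φ (h * p s) • q s = h)
    (hloc : ∀ h : M, ∃ c : k, IsNilpotent (h - algebraMap k M c)) (g₀ : M) (hg₀ : g₀ ≠ 0)
    (hsoc : ∀ h : M, IsNilpotent h → h * g₀ = 0) :
    (∃ c : k, c ≠ 0 ∧ ∑ s, p s * q s = c • g₀) ∧
      ∀ ψ : M →ₗ[k] k, ψ g₀ ≠ 0 → ∀ a, (∀ b, ψ (a * b) = 0) → a = 0 := by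
  set J := ∑ s, p s * q s with hJ
  have hnd : ∀ a, (∀ b, φ (a * b) = 0) → a = 0 := by
    intro a ha
    rw [← hpq a]
    exact Finset.sum_eq_zero fun s _ => by rw [ha, zero_smul]
  have hg₀mul : ∀ h c, IsNilpotent (h - algebraMap k M c) → h * g₀ = c • g₀ := by
    intro h c hc
    have := hsoc _ hc
    rwa [sub_mul, ← Algebra.smul_def, sub_eq_zero] at this
  have htr : φ J = Module.finrank k M := by
    rw [← one_mul J, ← trace_eq_residue_mul_jacobian φ p q hpq, ← map_one (algebraMap k M),
      Algebra.trace_algebraMap]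
    simp
  have htr0 : φ J ≠ 0 := by
    rw [htr]
    exact_mod_cast Module.finrank_pos.ne'
  have hJnil : ∀ h : M, IsNilpotent h → φ (h * J) = 0 := by
    intro h hh
    rw [← trace_eq_residue_mul_jacobian φ p q hpq, Algebra.trace_apply]
    refine (LinearMap.isNilpotent_trace_of_isNilpotent (M := M) ?_).eq_zero
    exact hh.map (Algebra.lmul k M)
  have hφg₀ : φ g₀ ≠ 0 := by
    intro h0
    refine hg₀ (hnd _ fun b => ?_)
    obtain ⟨c, hc⟩ := hloc b
    rw [mul_comm, hg₀mul b c hc, map_smul, h0, smul_zero]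
  refine ⟨⟨φ J / φ g₀, div_ne_zero htr0 hφg₀, ?_⟩, ?_⟩
  · rw [← sub_eq_zero]
    refine hnd _ fun b => ?_
    obtain ⟨c, hc⟩ := hloc b
    have h1 : φ (b * J) = c * φ J := by
      have := hJnil _ hc
      rw [sub_mul, map_sub, ← Algebra.smul_def, map_smul, sub_eq_zero] at this
      exact this
    rw [mul_comm, mul_sub, map_sub, h1, mul_smul_comm, map_smul, hg₀mul b c hc, map_smul]
    simp only [smul_eq_mul]
    field_simp
    ring
  · intro ψ hψ a ha
    -- Every form is `ψ = φ(· u)`. If `u` were nilpotent it would kill `g₀`, so `ψ g₀ ≠ 0` makes `u`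
    -- a unit and nondegeneracy passes from `φ` to `ψ`.
    let u := ∑ s, ψ (q s) • p s
    have hu : ∀ h, ψ h = φ (h * u) := by
      intro h
      conv_lhs => rw [← hpq h]
      simp only [u, Finset.mul_sum, map_sum, map_smul, mul_smul_comm, smul_eq_mul]
      exact Finset.sum_congr rfl fun s _ => mul_comm _ _
    obtain ⟨c, hc⟩ := hloc u
    have hc0 : c ≠ 0 := by
      rintro rfl
      apply hψ
      rw [hu, mul_comm, hg₀mul u 0 hc, zero_smul, map_zero]
    have hunit : IsUnit u := by
      have h1 : IsUnit (algebraMap k M c) := (isUnit_iff_ne_zero.2 hc0).map _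
      have := IsNilpotent.isUnit_add_left_of_commute hc h1 (Commute.all _ _)
      simpa using this
    obtain ⟨v, hv⟩ := hunit.exists_right_inv
    refine hnd a fun b => ?_
    have := ha (b * v)
    rw [hu] at this
    rw [← this]
    congr 1
    rw [show a * (b * v) * u = a * b * (u * v) by ring, hv, mul_one]

end DualSystem

/-! ### Linear independence over germs of functions of the parameters -/

section Independence

/-- A homomorphism from polynomials that sends the variables to nilpotent elements extends to
formal power series. -/
theorem exists_extension_of_isNilpotent {σ k B : Type*} [Finite σ] [CommRing k] [CommRing B]
    (κ : MvPolynomial σ k →+* B) (hκ : ∀ i, IsNilpotent (κ (MvPolynomial.X i))) (K : ℕ) :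
    ∃ M, K ≤ M ∧ ∃ Ψ : MvPowerSeries σ k →+* B,
      (∀ p, Ψ p = κ (MvPowerSeries.truncTotal M p)) ∧ ∀ p : MvPolynomial σ k, Ψ p = κ p := by
  have hfg : ((MvPolynomial.idealOfVars σ k).map κ).FG := (MvPolynomial.idealOfVars_fg σ k).map κ
  have hnil : IsNilpotent ((MvPolynomial.idealOfVars σ k).map κ) := by
    rw [Ideal.FG.isNilpotent_iff_le_nilradical hfg, MvPolynomial.idealOfVars, Ideal.map_span,
      Ideal.span_le]
    rintro _ ⟨_, ⟨i, rfl⟩, rfl⟩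
    exact hκ i
  obtain ⟨M, hM⟩ := hnil
  have hle : ∀ a ∈ MvPolynomial.idealOfVars σ k ^ (M + K), κ a = 0 := by
    intro a ha
    have h1 := Ideal.mem_map_of_mem κ (Ideal.pow_le_pow_right (Nat.le_add_right M K) ha)
    rw [Ideal.map_pow, hM] at h1
    exact h1
  -- Truncating at `M + K` rather than `M` changes nothing in `B`, but guarantees that coefficients
  -- of degree below `K` survive.
  refine ⟨M + K, Nat.le_add_left _ _, (Ideal.Quotient.lift _ κ hle).comp
    (MvPowerSeries.truncTotalAlgHom σ k (M + K)).toRingHom, fun p => rfl, fun p => ?_⟩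
  have := (MvPowerSeries.truncTotalAlgHom σ k (M + K)).commutes p
  exact congrArg (Ideal.Quotient.lift _ κ hle) this

theorem truncTotal_rename_eq_zero {σ τ : Type} {k : Type*} [Finite σ] [Finite τ] [CommRing k]
    (e : σ ↪ τ)
    (M : ℕ) (p : MvPowerSeries σ k) (hp : ∀ α : σ →₀ ℕ, α.degree < M → MvPowerSeries.coeff α p
        = 0) :
    MvPowerSeries.truncTotal M (MvPowerSeries.rename e p) = 0 := by
  ext α
  rw [MvPowerSeries.coeff_truncTotal_eq_ite, MvPolynomial.coeff_zero]
  split_ifs with h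
  · by_cases hα : α ∈ Set.range (Finsupp.embDomain e)
    · obtain ⟨α, rfl⟩ := hα
      rw [MvPowerSeries.coeff_embDomain_rename]
      exact hp α (degree_embDomain e α ▸ h)
    · rw [MvPowerSeries.coeff_rename_eq_zero]
      simpa [← Finsupp.embDomain_eq_mapDomain] using hα
  · rfl

variable {n μ : ℕ} {ι : Type*} [Fintype ι]

/-- The homomorphism `ℂ[x, u] → R[x]` given by a choice of values in `R` of the parameters `u`. -/
def substParams {R : Type*} [CommRing R] [Algebra ℂ R] (u : Fin μ → R) :
    MvPolynomial (Fin n ⊕ Fin μ) ℂ →ₐ[ℂ] MvPolynomial (Fin n) R :=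
  MvPolynomial.aeval (Sum.elim MvPolynomial.X fun j => MvPolynomial.C (u j))

/-- Base change of a relation among the `g k` to an Artinian base: in `A = R[x]/(F)` all coordinates
are nilpotent, so convergent series can be evaluated there and the relation becomes one over `R`.
The residue of `A` reduces independence to the special fibre. -/
theorem exists_aeval_truncTotal_eq_zero_of_surjective {R : Type*} [CommRing R] [Algebra ℂ R]
    (ε : R →ₐ[ℂ] ℂ) (K : ℕ) (hεker : RingHom.ker ε ^ K = ⊥) (u : Fin μ → R)
    (hu : ∀ j, ε (u j) = 0)
    (F : Fin n → MvPolynomial (Fin n ⊕ Fin μ) ℂ) (F₀ : Fin n → MvPolynomial (Fin n) ℂ)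
    (hF : ∀ i, MvPolynomial.killCompl Sum.inl_injective (F i) = F₀ i)
    (hN : ∀ i, ∃ N : ℕ, MvPolynomial.X i ^ N ∈ Ideal.span (Set.range F₀))
    (g : ι → MvPolynomial (Fin n) ℂ)
    {M₀ : Type*} [CommRing M₀] [Algebra ℂ M₀] (π₀ : MvPolynomial (Fin n) ℂ →ₐ[ℂ] M₀)
    (hπ₀ : ∀ i, π₀ (F₀ i) = 0) (hg : LinearIndependent ℂ fun k => π₀ (g k))
    (c : ι → Conv (Fin μ))
    (hc : ∑ k, pullback (Fin n) (Fin μ) (c k) * germ (MvPolynomial.rename Sum.inl (g k)) ∈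
      Ideal.span (Set.range fun i => germ (F i)))
    {A : Type*} [CommRing A] [Algebra R A] (π : MvPolynomial (Fin n) R →ₐ[R] A)
    (hπ : Function.Surjective π) (hker : ∀ p, π p = 0 ↔
      p ∈ Ideal.span (Set.range fun i => substParams u (F i))) :
    ∃ M, K ≤ M ∧ ∀ k, MvPolynomial.aeval u (MvPowerSeries.truncTotal M (toSeries (c k))) = 0 := by
  let θ : MvPolynomial (Fin n ⊕ Fin μ) ℂ →ₐ[ℂ] MvPolynomial (Fin n) R := substParams u
  let κ : MvPolynomial (Fin n ⊕ Fin μ) ℂ →+* A := π.toRingHom.comp θ.toRingHom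
  have hκX : ∀ i, κ (MvPolynomial.X (Sum.inl i)) = π (MvPolynomial.X i) := by
    intro i
    change π (θ _) = _
    simp [θ, substParams]
  have hκr : ∀ q, κ (MvPolynomial.rename Sum.inr q) = algebraMap R A (MvPolynomial.aeval u q) := by
    intro q
    have : θ.comp (MvPolynomial.rename Sum.inr) =
        (IsScalarTower.toAlgHom ℂ R (MvPolynomial (Fin n) R)).comp (MvPolynomial.aeval u) := by
      refine MvPolynomial.algHom_ext fun j => ?_
      simp [θ, substParams, MvPolynomial.algebraMap_eq]
    have h := DFunLike.congr_fun this q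
    change π (θ _) = _
    rw [← AlgHom.comp_apply, h]
    exact π.commutes _
  have hκl : ∀ q, κ (MvPolynomial.rename Sum.inl q) =
      π (MvPolynomial.map (algebraMap ℂ R) q) := by
    intro q
    change π (θ _) = _
    congr 1
    have : θ.comp (MvPolynomial.rename Sum.inl) =
        MvPolynomial.mapAlgHom (Algebra.ofId ℂ R) := by
      refine MvPolynomial.algHom_ext fun j => ?_
      simp [θ, substParams]
    exact DFunLike.congr_fun this q
  have hκF : ∀ i, κ (F i) = 0 := fun i => (hker _).2 (Ideal.subset_span ⟨i, rfl⟩)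
  have hnilr : ∀ j, IsNilpotent (κ (MvPolynomial.X (Sum.inr j))) := by
    intro j
    have := hκr (MvPolynomial.X j)
    rw [MvPolynomial.rename_X] at this
    rw [this]
    refine IsNilpotent.map (r := MvPolynomial.aeval u (MvPolynomial.X j)) ⟨K, ?_⟩ (algebraMap R A)
    rw [MvPolynomial.aeval_X, ← Ideal.mem_bot, ← hεker]
    exact Ideal.pow_mem_pow (hu j) K
  -- Modulo the nilradical the parameters vanish, so `F` becomes `F₀`, and some power of `X i` lies
  -- in the ideal of `F₀`.
  have hnill : ∀ i, IsNilpotent (κ (MvPolynomial.X (Sum.inl i))) := by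
    intro i
    let κ' : MvPolynomial (Fin n ⊕ Fin μ) ℂ →+* A ⧸ nilradical A :=
      (Ideal.Quotient.mk (nilradical A)).comp κ
    have hcomp : ∀ q, κ' (MvPolynomial.rename Sum.inl (MvPolynomial.killCompl
        Sum.inl_injective q)) = κ' q := by
      intro q
      induction q using MvPolynomial.induction_on with
      | C a => simp [MvPolynomial.killCompl]
      | add p q hp hq => rw [map_add, map_add, map_add, hp, hq, map_add]
      | mul_X p j hp =>
        rw [map_mul, map_mul, map_mul, hp, map_mul]
        congr 1
        rcases j with j | j
        · have : MvPolynomial.killCompl (R := ℂ) Sum.inl_injective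
              (MvPolynomial.X (Sum.inl j : Fin n ⊕ Fin μ)) = MvPolynomial.X j := by
            have := MvPolynomial.killCompl_rename_app (R := ℂ)
              (Sum.inl_injective (α := Fin n) (β := Fin μ)) (MvPolynomial.X j)
            simpa using this
          rw [this, MvPolynomial.rename_X]
        · have h2 : MvPolynomial.killCompl (R := ℂ) Sum.inl_injective
              (MvPolynomial.X (Sum.inr j : Fin n ⊕ Fin μ)) = 0 := by
            simp [MvPolynomial.killCompl]
          rw [h2, map_zero, map_zero]
          exact (Ideal.Quotient.eq_zero_iff_mem.2 (hnilr j)).symm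
    obtain ⟨N, hN⟩ := hN i
    obtain ⟨a, ha⟩ := Ideal.mem_span_range_iff_exists_fun.1 hN
    have h1 : κ' (MvPolynomial.X (Sum.inl i)) ^ N = 0 := by
      rw [← map_pow, ← MvPolynomial.rename_X (R := ℂ) Sum.inl i, ← map_pow, ← ha, map_sum, map_sum]
      refine Finset.sum_eq_zero fun j _ => ?_
      rw [map_mul, map_mul, ← hF, hcomp]
      change _ * Ideal.Quotient.mk (nilradical A) (κ (F j)) = 0
      rw [hκF, map_zero, mul_zero]
    rw [← map_pow] at h1
    have h2 : κ (MvPolynomial.X (Sum.inl i) ^ N) ∈ nilradical A :=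
      Ideal.Quotient.eq_zero_iff_mem.1 h1
    rw [mem_nilradical, map_pow] at h2
    obtain ⟨l, hl⟩ := h2
    exact ⟨N * l, by rw [pow_mul, hl]⟩
  obtain ⟨N, hN'⟩ : ∃ N : ℕ, ∀ i, π (MvPolynomial.X i) ^ (N + 1) = 0 := by
    choose l hl using hnill
    refine ⟨∑ i, l i, fun i => ?_⟩
    rw [← hκX]
    exact pow_eq_zero_of_le ((Finset.single_le_sum (f := l) (fun _ _ => Nat.zero_le _)
      (Finset.mem_univ i)).trans (Nat.le_succ _)) (hl i)
  obtain ⟨φ, s, p, q, hpq, -⟩ := exists_residue π hπ _ hker N hN'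
  have hρ₀ : ∀ a ∈ Ideal.span (Set.range fun i => θ (F i)),
      (π₀.toRingHom.comp (MvPolynomial.map (ε : R →+* ℂ))) a = 0 := by
    intro a ha
    obtain ⟨b, rfl⟩ := Ideal.mem_span_range_iff_exists_fun.1 ha
    rw [map_sum]
    refine Finset.sum_eq_zero fun i _ => ?_
    have h1 : (MvPolynomial.mapAlgHom ε).comp θ =
        MvPolynomial.killCompl Sum.inl_injective := by
      refine MvPolynomial.algHom_ext fun j => ?_
      rcases j with j | j
      · have := MvPolynomial.killCompl_rename_app (R := ℂ)
            (Sum.inl_injective (α := Fin n) (β := Fin μ)) (MvPolynomial.X j)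
        rw [MvPolynomial.rename_X] at this
        rw [this]
        simp [θ, substParams]
      · simp [θ, substParams, MvPolynomial.killCompl, hu]
    have h2 : MvPolynomial.map (ε : R →+* ℂ) (θ (F i)) = F₀ i := by
      rw [← hF, ← h1]; rfl
    rw [map_mul, RingHom.comp_apply π₀.toRingHom _ (θ (F i)), h2]
    exact mul_eq_zero_of_right _ (hπ₀ i)
  let ρ : A →+* M₀ := RingHom.liftOfSurjective π.toRingHom hπ
    ⟨π₀.toRingHom.comp (MvPolynomial.map (ε : R →+* ℂ)), fun a ha => hρ₀ a ((hker a).1 ha)⟩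
  have hρπ : ∀ a, ρ (π a) = π₀ (MvPolynomial.map (ε : R →+* ℂ) a) :=
    fun a => RingHom.liftOfRightInverse_comp_apply _ _ _ _ a
  have hli : LinearIndependent R fun k => π (MvPolynomial.map (algebraMap ℂ R) (g k)) := by
    refine linearIndependent_of_residue ε K hεker ρ (fun r => ?_) φ p q hpq _ ?_
    · rw [← AlgHom.commutes π, MvPolynomial.algebraMap_eq, hρπ, MvPolynomial.map_C]
      exact π₀.commutes (ε r)
    · have h1 : (ε : R →+* ℂ).comp (algebraMap ℂ R) = RingHom.id ℂ :=
        RingHom.ext fun z => ε.commutes z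
      have h2 : (fun k => ρ (π (MvPolynomial.map (algebraMap ℂ R) (g k)))) =
          fun k => π₀ (g k) := by
        funext k
        rw [hρπ, MvPolynomial.map_map, h1, MvPolynomial.map_id]
      rw [h2]
      exact hg
  obtain ⟨M, hKM, Ψ, hΨ, hΨp⟩ := exists_extension_of_isNilpotent κ
    (Sum.rec hnill hnilr) K
  -- A series in the parameters differs from its truncation by terms of total degree at least `M`,
  -- which `Ψ` ignores.
  have hΨr : ∀ x : MvPowerSeries (Fin μ) ℂ, Ψ (MvPowerSeries.rename Function.Embedding.inr x) =
      algebraMap R A (MvPolynomial.aeval u (MvPowerSeries.truncTotal M x)) := by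
    intro x
    have h1 : MvPowerSeries.truncTotal M (MvPowerSeries.rename
        (Function.Embedding.inr : Fin μ ↪ Fin n ⊕ Fin μ)
        (x - (MvPowerSeries.truncTotal M x : MvPowerSeries (Fin μ) ℂ))) = 0 := by
      refine truncTotal_rename_eq_zero _ M _ fun α hα => ?_
      rw [map_sub, MvPolynomial.coeff_coe, MvPowerSeries.coeff_truncTotal _ hα, sub_self]
    have h2 := hΨ (MvPowerSeries.rename (Function.Embedding.inr : Fin μ ↪ Fin n ⊕ Fin μ)
        (x - (MvPowerSeries.truncTotal M x : MvPowerSeries (Fin μ) ℂ)))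
    rw [h1, map_zero, map_sub, map_sub, sub_eq_zero, MvPowerSeries.rename_coe, hΨp] at h2
    rw [h2, ← hκr]
    rfl
  have hsum : ∑ k, (MvPolynomial.aeval u (MvPowerSeries.truncTotal M (toSeries (c k)))) •
      π (MvPolynomial.map (algebraMap ℂ R) (g k)) = 0 := by
    obtain ⟨b, hb⟩ := Ideal.mem_span_range_iff_exists_fun.1 hc
    have h1 := congrArg (fun z => Ψ (toSeries z)) hb
    simp only [map_sum, map_mul, toSeries_germ, hΨp, hκF, mul_zero, Finset.sum_const_zero,
      toSeries_pullback, hΨr, hκl] at h1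
    rw [h1]
    exact Finset.sum_congr rfl fun k _ => Algebra.smul_def _ _
  exact ⟨M, hKM, Fintype.linearIndependent_iff.1 hli _ hsum⟩

theorem exists_aeval_truncTotal_eq_zero {R : Type*} [CommRing R] [Algebra ℂ R]
    (ε : R →ₐ[ℂ] ℂ) (K : ℕ) (hεker : RingHom.ker ε ^ K = ⊥) (u : Fin μ → R)
    (hu : ∀ j, ε (u j) = 0)
    (F : Fin n → MvPolynomial (Fin n ⊕ Fin μ) ℂ) (F₀ : Fin n → MvPolynomial (Fin n) ℂ)
    (hF : ∀ i, MvPolynomial.killCompl Sum.inl_injective (F i) = F₀ i)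
    (hN : ∀ i, ∃ N : ℕ, MvPolynomial.X i ^ N ∈ Ideal.span (Set.range F₀))
    (g : ι → MvPolynomial (Fin n) ℂ)
    {M₀ : Type*} [CommRing M₀] [Algebra ℂ M₀] (π₀ : MvPolynomial (Fin n) ℂ →ₐ[ℂ] M₀)
    (hπ₀ : ∀ i, π₀ (F₀ i) = 0) (hg : LinearIndependent ℂ fun k => π₀ (g k))
    (c : ι → Conv (Fin μ))
    (hc : ∑ k, pullback (Fin n) (Fin μ) (c k) * germ (MvPolynomial.rename Sum.inl (g k)) ∈
      Ideal.span (Set.range fun i => germ (F i))) :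
    ∃ M, K ≤ M ∧ ∀ k, MvPolynomial.aeval u (MvPowerSeries.truncTotal M (toSeries (c k))) = 0 :=
  exists_aeval_truncTotal_eq_zero_of_surjective ε K hεker u hu F F₀ hF hN g π₀ hπ₀ hg c hc
    (Ideal.Quotient.mkₐ R (Ideal.span (Set.range fun i => substParams u (F i))))
    (Ideal.Quotient.mkₐ_surjective R _) fun _ => Ideal.Quotient.eq_zero_iff_mem

/-- To kill the coefficient of `c k` at `α`, take the base `ℂ[u]/(u)^K` with `K = α.degree + 1`: the
preceding result says that `c k` vanishes modulo `(u)^K`. -/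
theorem eq_zero_of_sum_pullback_mul_germ_mem
    (F : Fin n → MvPolynomial (Fin n ⊕ Fin μ) ℂ) (F₀ : Fin n → MvPolynomial (Fin n) ℂ)
    (hF : ∀ i, MvPolynomial.killCompl Sum.inl_injective (F i) = F₀ i)
    (hN : ∀ i, ∃ N : ℕ, MvPolynomial.X i ^ N ∈ Ideal.span (Set.range F₀))
    (g : ι → MvPolynomial (Fin n) ℂ)
    {M₀ : Type*} [CommRing M₀] [Algebra ℂ M₀] (π₀ : MvPolynomial (Fin n) ℂ →ₐ[ℂ] M₀)
    (hπ₀ : ∀ i, π₀ (F₀ i) = 0) (hg : LinearIndependent ℂ fun k => π₀ (g k))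
    (c : ι → Conv (Fin μ))
    (hc : ∑ k, pullback (Fin n) (Fin μ) (c k) * germ (MvPolynomial.rename Sum.inl (g k)) ∈
      Ideal.span (Set.range fun i => germ (F i))) (k : ι) : c k = 0 := by
  apply toSeries_injective
  rw [map_zero]
  ext α
  rw [MvPowerSeries.coeff_zero]
  obtain ⟨K, hK⟩ : ∃ K, K = α.degree + 1 := ⟨_, rfl⟩
  have hε₀ : ∀ a ∈ MvPolynomial.idealOfVars (Fin μ) ℂ ^ K,
      MvPolynomial.aeval (fun _ => (0 : ℂ)) a = 0 := by
    intro a ha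
    have h1 := (MvPolynomial.mem_pow_idealOfVars_iff' K a).1 ha 0 (by simp [hK])
    rw [MvPolynomial.aeval_zero', MvPolynomial.constantCoeff_eq, h1, map_zero]
  let ε : MvPolynomial (Fin μ) ℂ ⧸ MvPolynomial.idealOfVars (Fin μ) ℂ ^ K →ₐ[ℂ] ℂ :=
      Ideal.Quotient.liftₐ _ (MvPolynomial.aeval fun _ => (0 : ℂ)) hε₀
  have hεmk : ∀ a, ε (Ideal.Quotient.mk _ a) = MvPolynomial.constantCoeff a := by
    intro a
    change MvPolynomial.aeval (fun _ => (0 : ℂ)) a = _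
    rw [MvPolynomial.aeval_zero']; rfl
  have hεker : RingHom.ker ε ^ K = ⊥ := by
    have h1 : RingHom.ker ε ≤ (MvPolynomial.idealOfVars (Fin μ) ℂ).map
        (Ideal.Quotient.mk (MvPolynomial.idealOfVars (Fin μ) ℂ ^ K)) := by
      intro x hx
      obtain ⟨x, rfl⟩ := Ideal.Quotient.mk_surjective x
      rw [RingHom.mem_ker, hεmk] at hx
      refine Ideal.mem_map_of_mem _ ?_
      rw [← pow_one (MvPolynomial.idealOfVars (Fin μ) ℂ), MvPolynomial.mem_pow_idealOfVars_iff']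
      intro β hβ
      have : β = 0 := by
        rw [← Finsupp.degree_eq_zero_iff]; omega
      rw [this]
      exact hx
    rw [eq_bot_iff]
    refine (Ideal.pow_right_mono h1 K).trans ?_
    rw [← Ideal.map_pow, Ideal.map_quotient_self]
  obtain ⟨M, hKM, hM⟩ := exists_aeval_truncTotal_eq_zero ε K hεker
    (fun j => Ideal.Quotient.mk _ (MvPolynomial.X j)) (fun j => by rw [hεmk]; simp)
    F F₀ hF hN g π₀ hπ₀ hg c hc
  have hzero := hM k
  have hae : MvPolynomial.aeval (fun j => Ideal.Quotient.mk
      (MvPolynomial.idealOfVars (Fin μ) ℂ ^ K) (MvPolynomial.X j)) =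
      Ideal.Quotient.mkₐ ℂ (MvPolynomial.idealOfVars (Fin μ) ℂ ^ K) :=
    MvPolynomial.algHom_ext fun j => by simp
  rw [hae] at hzero
  have h3 := (MvPolynomial.mem_pow_idealOfVars_iff' K _).1 (Ideal.Quotient.eq_zero_iff_mem.1 hzero)
    α (by omega)
  rwa [MvPowerSeries.coeff_truncTotal _ (by omega)] at h3

end Independence

/-! ### Weighted homogeneous ideals -/

section Graded

variable {n : ℕ}

theorem exists_lt_weight_of_le_degree {σ : Type*} [Finite σ] (w : σ → ℚ) (hw : ∀ i, 0 < w i)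
    (D : ℚ) : ∃ M : ℕ, ∀ α : σ →₀ ℕ, M ≤ α.degree → D < Finsupp.weight w α := by
  obtain ⟨c, hc0, hc⟩ : ∃ c : ℚ, 0 < c ∧ ∀ i, c ≤ w i := by
    rcases isEmpty_or_nonempty σ with h | h
    · exact ⟨1, one_pos, fun i => h.elim i⟩
    · obtain ⟨i, hi⟩ := Finite.exists_min w
      exact ⟨w i, hw i, hi⟩
  obtain ⟨M, hM⟩ := exists_nat_gt (D / c)
  refine ⟨M, fun α hα => ?_⟩
  calc D < M * c := (div_lt_iff₀ hc0).1 hM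
    _ ≤ α.degree * c := by gcongr
    _ ≤ Finsupp.weight w α := by
      rw [Finsupp.weight_apply, Finsupp.degree_apply, Finsupp.sum, Nat.cast_sum, Finset.sum_mul]
      refine Finset.sum_le_sum fun i _ => ?_
      rw [nsmul_eq_mul]
      exact mul_le_mul_of_nonneg_left (hc i) (Nat.cast_nonneg _)

attribute [local instance] MvPolynomial.weightedGradedAlgebra

theorem isHomogeneous_span_of_isWeightedHomogeneous {ι : Type*} (w : Fin n → ℚ) (δ : ι → ℚ)
    (F : ι → MvPolynomial (Fin n) ℂ) (hF : ∀ i, MvPolynomial.IsWeightedHomogeneous w (F i) (δ i)) :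
    (Ideal.span (Set.range F)).IsHomogeneous
      (MvPolynomial.weightedHomogeneousSubmodule ℂ w) := by
  refine Ideal.homogeneous_span _ _ ?_
  rintro _ ⟨i, rfl⟩
  exact ⟨δ i, hF i⟩

/-- An ideal generated by weighted homogeneous polynomials for positive weights is determined by
its germ at the origin. -/
theorem mem_span_of_germ_mem_span {ι : Type*} [Fintype ι] (w : Fin n → ℚ) (hw : ∀ i, 0 < w i)
    (δ : ι → ℚ) (F : ι → MvPolynomial (Fin n) ℂ)
    (hF : ∀ i, MvPolynomial.IsWeightedHomogeneous w (F i) (δ i)) (p : MvPolynomial (Fin n) ℂ)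
    (hp : germ p ∈ Ideal.span (Set.range fun i => germ (F i))) :
    p ∈ Ideal.span (Set.range F) := by
  have hI := isHomogeneous_span_of_isWeightedHomogeneous w δ F hF
  rw [MvPolynomial.mem_iff_weightedHomogeneousComponent_mem _ _ hI]
  intro D
  obtain ⟨M, hM⟩ := exists_lt_weight_of_le_degree w hw D
  obtain ⟨a, ha⟩ := Ideal.mem_span_range_iff_exists_fun.1 hp
  -- Truncating the analytic coefficients changes only monomials of degree at least `M`. These have
  -- weight above `D`, so `p` and `t` have the same component of weight `D`.
  let t := ∑ i, MvPowerSeries.truncTotal M (toSeries (a i)) * F i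
  have ht : t ∈ Ideal.span (Set.range F) :=
    sum_mem fun i _ => Ideal.mul_mem_left _ _ (Ideal.subset_span ⟨i, rfl⟩)
  have hpt : p - t ∈ MvPolynomial.idealOfVars (Fin n) ℂ ^ M := by
    rw [← Ideal.Quotient.eq]
    have h1 := congrArg (fun z => MvPowerSeries.truncTotalAlgHom (Fin n) ℂ M (toSeries z)) ha
    have h2 : ∀ q : MvPolynomial (Fin n) ℂ,
        MvPowerSeries.truncTotalAlgHom (Fin n) ℂ M (q : MvPowerSeries (Fin n) ℂ) =
          Ideal.Quotient.mk _ q := fun q =>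
      (MvPowerSeries.truncTotalAlgHom (Fin n) ℂ M).commutes q
    simp only [map_sum, map_mul, toSeries_germ, h2] at h1
    rw [← h1]
    simp only [t, map_sum, map_mul]
    rfl
  have h0 : MvPolynomial.weightedHomogeneousComponent w D (p - t) = 0 := by
    ext α
    rw [MvPolynomial.coeff_weightedHomogeneousComponent, MvPolynomial.coeff_zero]
    split_ifs with hα
    · refine (MvPolynomial.mem_pow_idealOfVars_iff' M _).1 hpt α ?_
      by_contra h
      exact (hM α (not_lt.1 h)).ne' hα
    · rfl
  rw [map_sub, sub_eq_zero] at h0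
  rw [h0]
  exact MvPolynomial.weightedHomogeneousComponent_mem_of_mem _ _ hI ht D

variable {μ : ℕ}

/-- The class in the Jacobian algebra, as a homomorphism. -/
def classHom (f : MvPolynomial (Fin n) ℂ) : MvPolynomial (Fin n) ℂ →ₐ[ℂ] JacobianAlgebra f :=
  (Ideal.Quotient.mkₐ ℂ (jacobianIdeal f)).comp germ

/-- Makes `M_f` a polynomial complete intersection, so that the algebraic residue applies to an
algebra defined by germs. -/
theorem classHom_eq_zero_iff (w : Fin n → ℚ) (hw : ∀ i, 0 < w i) (d : ℚ)
    (f : MvPolynomial (Fin n) ℂ) (hf : MvPolynomial.IsWeightedHomogeneous w f d) (p : MvPolynomial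
        (Fin n) ℂ) :
    classHom f p = 0 ↔ p ∈ Ideal.span (Set.range fun i => MvPolynomial.pderiv i f) := by
  constructor
  · intro h
    refine mem_span_of_germ_mem_span w hw (fun i => d - w i) _
      (fun i => hf.pderiv (sub_add_cancel _ _)) p ?_
    exact Ideal.Quotient.eq_zero_iff_mem.1 h
  · intro h
    obtain ⟨a, rfl⟩ := Ideal.mem_span_range_iff_exists_fun.1 h
    refine Ideal.Quotient.eq_zero_iff_mem.2 ?_
    rw [map_sum]
    refine sum_mem fun i _ => ?_
    rw [map_mul]
    exact Ideal.mul_mem_left _ _ (Ideal.subset_span ⟨i, rfl⟩)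

/-- A weighted homogeneous polynomial whose degree is not among those of a weighted homogeneous
basis has class zero in the Jacobian algebra. -/
theorem classHom_eq_zero_of_degree_ne (w : Fin n → ℚ) (hw : ∀ i, 0 < w i) (d : ℚ)
    (f : MvPolynomial (Fin n) ℂ) (hf : MvPolynomial.IsWeightedHomogeneous w f d)
    (g : Fin μ → MvPolynomial (Fin n) ℂ) (e : Fin μ → ℚ)
    (hg : ∀ k, MvPolynomial.IsWeightedHomogeneous w (g k) (e k))
    (hspan : Submodule.span ℂ (Set.range fun k => classM f (g k)) = ⊤)
    (p : MvPolynomial (Fin n) ℂ) (D : ℚ) (hp : MvPolynomial.IsWeightedHomogeneous w p D)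
    (hD : ∀ k, e k ≠ D) : classHom f p = 0 := by
  have h1 : classHom f p ∈ Submodule.span ℂ (Set.range fun k => classM f (g k)) := by
    rw [hspan]; trivial
  obtain ⟨c, hc⟩ := (Submodule.mem_span_range_iff_exists_fun ℂ).1 h1
  have h2 : classHom f (p - ∑ k, c k • g k) = 0 := by
    rw [map_sub, map_sum, ← hc, sub_eq_zero]
    exact Finset.sum_congr rfl fun k _ => (map_smul (classHom f) _ _).symm
  rw [classHom_eq_zero_iff w hw d f hf] at h2 ⊢
  -- The Jacobian ideal is graded, and the part of weight `D` of `p - ∑ c k • g k` is `p` alone.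
  have h3 := MvPolynomial.weightedHomogeneousComponent_mem_of_mem _ _
    (isHomogeneous_span_of_isWeightedHomogeneous w (fun i => d - w i) _
      (fun i => hf.pderiv (sub_add_cancel _ _))) h2 D
  rw [map_sub, map_sum, hp.weightedHomogeneousComponent_same, Finset.sum_eq_zero, sub_zero] at h3
  · exact h3
  · intro k _
    rw [map_smul, (hg k).weightedHomogeneousComponent_ne _ (hD k).symm, smul_zero]

/-- A high power of a coordinate has weight above every `e k`, so its class is zero. The form `N +
1` makes `N` the top exponent in the residue. -/
theorem classHom_X_pow_eq_zero (w : Fin n → ℚ) (hw : ∀ i, 0 < w i) (d : ℚ)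
    (f : MvPolynomial (Fin n) ℂ) (hf : MvPolynomial.IsWeightedHomogeneous w f d)
    (g : Fin μ → MvPolynomial (Fin n) ℂ) (e : Fin μ → ℚ)
    (hg : ∀ k, MvPolynomial.IsWeightedHomogeneous w (g k) (e k))
    (hspan : Submodule.span ℂ (Set.range fun k => classM f (g k)) = ⊤) :
    ∃ N : ℕ, ∀ i, classHom f (MvPolynomial.X i) ^ (N + 1) = 0 := by
  have h : ∀ i, ∃ N : ℕ, classHom f (MvPolynomial.X i) ^ N = 0 := by
    intro i
    obtain ⟨B, hB⟩ : ∃ B : ℚ, ∀ k, e k ≤ B := by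
      obtain ⟨B, hB⟩ := (Set.finite_range e).bddAbove
      exact ⟨B, fun k => hB ⟨k, rfl⟩⟩
    obtain ⟨N, hN⟩ := exists_nat_gt (B / w i)
    refine ⟨N, ?_⟩
    rw [← map_pow]
    refine classHom_eq_zero_of_degree_ne w hw d f hf g e hg hspan _ (N • w i)
      ((MvPolynomial.isWeightedHomogeneous_X ℂ w i).pow N) fun k => ?_
    rw [nsmul_eq_mul]
    exact ((hB k).trans_lt ((div_lt_iff₀ (hw i)).1 hN)).ne
  choose l hl using h
  refine ⟨∑ i, l i, fun i => ?_⟩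
  exact pow_eq_zero_of_le ((Finset.single_le_sum (f := l) (fun _ _ => Nat.zero_le _)
    (Finset.mem_univ i)).trans (Nat.le_succ _)) (hl i)

/-- The weighted homogeneous basis element of highest degree lies in the socle. -/
theorem mul_classHom_eq_zero_of_isNilpotent (w : Fin n → ℚ) (hw : ∀ i, 0 < w i) (d : ℚ)
    (f : MvPolynomial (Fin n) ℂ) (hf : MvPolynomial.IsWeightedHomogeneous w f d)
    (g : Fin μ → MvPolynomial (Fin n) ℂ) (e : Fin μ → ℚ)
    (hg : ∀ k, MvPolynomial.IsWeightedHomogeneous w (g k) (e k))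
    (hspan : Submodule.span ℂ (Set.range fun k => classM f (g k)) = ⊤)
    (j : Fin μ) (hj : ∀ k, e k ≤ e j) (p : MvPolynomial (Fin n) ℂ) :
    classHom f (p - MvPolynomial.C (MvPolynomial.constantCoeff p)) * classHom f (g j) = 0 := by
  have h : p - MvPolynomial.C (MvPolynomial.constantCoeff p) ∈
      MvPolynomial.idealOfVars (Fin n) ℂ ^ 1 := by
    rw [MvPolynomial.mem_pow_idealOfVars_iff']
    intro α hα
    have : α = 0 := by
      rw [← Finsupp.degree_eq_zero_iff]; omega
    subst this
    simp [MvPolynomial.constantCoeff_eq]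
  rw [pow_one] at h
  obtain ⟨a, ha⟩ := Ideal.mem_span_range_iff_exists_fun.1 h
  rw [← ha, map_sum, Finset.sum_mul]
  refine Finset.sum_eq_zero fun i _ => ?_
  rw [map_mul, mul_assoc, ← map_mul]
  refine mul_eq_zero_of_right _ ?_
  refine classHom_eq_zero_of_degree_ne w hw d f hf g e hg hspan _ (w i + e j)
    ((MvPolynomial.isWeightedHomogeneous_X ℂ w i).mul (hg j)) fun k => ?_
  have := hj k
  have := hw i
  linarith

end Graded

/-! ### Weighted norms of power series -/

section WeightedNorm

open scoped NNReal ENNReal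

variable {σ : Type}

/-- The value of a monomial at a point with nonnegative coordinates. -/
def monoVal (ρ : σ → ℝ≥0) (α : σ →₀ ℕ) : ℝ≥0 := α.prod fun i k => ρ i ^ k

theorem monoVal_add (ρ : σ → ℝ≥0) (α β : σ →₀ ℕ) :
    monoVal ρ (α + β) = monoVal ρ α * monoVal ρ β := by
  classical
  exact Finsupp.prod_add_index' (fun _ => pow_zero _) fun _ _ _ => pow_add _ _ _

theorem monoVal_single (ρ : σ → ℝ≥0) (i : σ) (k : ℕ) :
    monoVal ρ (Finsupp.single i k) = ρ i ^ k :=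
  Finsupp.prod_single_index (pow_zero _)

theorem monoVal_pos {ρ : σ → ℝ≥0} (hρ : ∀ i, 0 < ρ i) (α : σ →₀ ℕ) : 0 < monoVal ρ α :=
  Finset.prod_pos fun i _ => pow_pos (hρ i) _

theorem monoVal_const (r : ℝ≥0) (α : σ →₀ ℕ) : monoVal (fun _ => r) α = r ^ α.degree := by
  rw [monoVal, Finsupp.prod, Finset.prod_pow_eq_pow_sum, Finsupp.degree_apply]

theorem monoVal_mono {ρ ρ' : σ → ℝ≥0} (h : ∀ i, ρ i ≤ ρ' i) (α : σ →₀ ℕ) :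
    monoVal ρ α ≤ monoVal ρ' α :=
  Finset.prod_le_prod' fun i _ => pow_le_pow_left' (h i) _

/-- The weighted `ℓ¹` norm of a power series on a polydisc. -/
def wnorm (ρ : σ → ℝ≥0) (p : MvPowerSeries σ ℂ) : ℝ≥0∞ :=
  ∑' α, ‖MvPowerSeries.coeff α p‖ₑ * monoVal ρ α

theorem wnorm_add_le (ρ : σ → ℝ≥0) (p q : MvPowerSeries σ ℂ) :
    wnorm ρ (p + q) ≤ wnorm ρ p + wnorm ρ q := by
  rw [wnorm, wnorm, wnorm, ← ENNReal.tsum_add]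
  refine ENNReal.tsum_le_tsum fun α => ?_
  rw [← add_mul, map_add]
  gcongr
  exact enorm_add_le _ _

theorem wnorm_zero (ρ : σ → ℝ≥0) : wnorm ρ 0 = 0 := by simp [wnorm]

theorem wnorm_neg (ρ : σ → ℝ≥0) (p : MvPowerSeries σ ℂ) : wnorm ρ (-p) = wnorm ρ p := by
  simp [wnorm]

theorem wnorm_sum_le {κ : Type*} (ρ : σ → ℝ≥0) (s : Finset κ) (p : κ → MvPowerSeries σ ℂ) :
    wnorm ρ (∑ k ∈ s, p k) ≤ ∑ k ∈ s, wnorm ρ (p k) :=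
  Finset.le_sum_of_subadditive _ (wnorm_zero ρ).le (wnorm_add_le ρ) s p

theorem wnorm_mul_le (ρ : σ → ℝ≥0) (p q : MvPowerSeries σ ℂ) :
    wnorm ρ (p * q) ≤ wnorm ρ p * wnorm ρ q := by
  classical
  let F : (σ →₀ ℕ) → (σ →₀ ℕ) → ℝ≥0∞ := fun α β =>
    (‖MvPowerSeries.coeff α p‖ₑ * monoVal ρ α) * (‖MvPowerSeries.coeff β q‖ₑ * monoVal ρ β)
  calc wnorm ρ (p * q) ≤ ∑' γ, ∑ x ∈ Finset.HasAntidiagonal.antidiagonal γ, F x.1 x.2 := by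
        refine ENNReal.tsum_le_tsum fun γ => ?_
        rw [MvPowerSeries.coeff_mul]
        refine (mul_le_mul_left (enorm_sum_le _ _) _).trans ?_
        rw [Finset.sum_mul]
        refine Finset.sum_le_sum fun x hx => ?_
        rw [← Finset.HasAntidiagonal.mem_antidiagonal.mp hx, monoVal_add, enorm_mul,
          ENNReal.coe_mul]
        exact le_of_eq (by ring)
    _ = ∑' x : (σ →₀ ℕ) × (σ →₀ ℕ), F x.1 x.2 := by
        rw [← Finset.HasAntidiagonal.sigmaAntidiagonalEquivProd.tsum_eq, ENNReal.tsum_sigma']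
        refine tsum_congr fun γ => ?_
        rw [← Finset.tsum_subtype]
        rfl
    _ = wnorm ρ p * wnorm ρ q := by
        rw [ENNReal.tsum_prod, wnorm, wnorm, ← ENNReal.tsum_mul_right]
        refine tsum_congr fun α => ?_
        rw [← ENNReal.tsum_mul_left]

theorem wnorm_le_mul_wnorm {ρ ρ' : σ → ℝ≥0} (t : ℝ≥0) (p : MvPowerSeries σ ℂ)
    (h : ∀ α, MvPowerSeries.coeff α p ≠ 0 → monoVal ρ' α ≤ t * monoVal ρ α) :
    wnorm ρ' p ≤ t * wnorm ρ p := by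
  rw [wnorm, wnorm, ← ENNReal.tsum_mul_left]
  refine ENNReal.tsum_le_tsum fun α => ?_
  by_cases hα : MvPowerSeries.coeff α p = 0
  · simp [hα]
  · rw [mul_left_comm]
    gcongr
    exact_mod_cast h α hα

theorem wnorm_mono {ρ ρ' : σ → ℝ≥0} (h : ∀ i, ρ' i ≤ ρ i) (p : MvPowerSeries σ ℂ) :
    wnorm ρ' p ≤ wnorm ρ p := by
  have := wnorm_le_mul_wnorm (ρ := ρ) (ρ' := ρ') 1 p fun α _ => by
    rw [one_mul]; exact monoVal_mono h α
  simpa using this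

theorem wnorm_coe_ne_top (ρ : σ → ℝ≥0) (p : MvPolynomial σ ℂ) :
    wnorm ρ (p : MvPowerSeries σ ℂ) ≠ ⊤ := by
  rw [wnorm, tsum_eq_sum (s := p.support)]
  · exact ENNReal.sum_ne_top.2 fun α _ => ENNReal.mul_ne_top enorm_ne_top ENNReal.coe_ne_top
  · intro α hα
    rw [MvPolynomial.coeff_coe, MvPolynomial.notMem_support_iff.1 hα, enorm_zero, zero_mul]

theorem exists_pos_le_one_mul_le {N : ℝ≥0∞} (hN : N ≠ ⊤) {δ : ℝ≥0} (hδ : 0 < δ) :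
    ∃ t : ℝ≥0, 0 < t ∧ t ≤ 1 ∧ t * N ≤ δ := by
  lift N to ℝ≥0 using hN
  refine ⟨min 1 (δ / (N + 1)), lt_min one_pos (by positivity), min_le_left _ _, ?_⟩
  have h : min 1 (δ / (N + 1)) * N ≤ δ := by
    calc min 1 (δ / (N + 1)) * N ≤ δ / (N + 1) * (N + 1) := by
          gcongr
          · exact min_le_right _ _
          · simp
      _ = δ := div_mul_cancel₀ _ (by positivity)
  exact_mod_cast h

theorem wnorm_const_ne_top_iff (r : ℝ≥0) (p : MvPowerSeries σ ℂ) :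
    wnorm (fun _ => r) p ≠ ⊤ ↔
      Summable fun α : σ →₀ ℕ => ‖MvPowerSeries.coeff α p‖ * (r : ℝ) ^ α.degree := by
  have : wnorm (fun _ => r) p =
      ∑' α : σ →₀ ℕ, ((‖MvPowerSeries.coeff α p‖₊ * r ^ α.degree : ℝ≥0) : ℝ≥0∞) := by
    refine tsum_congr fun α => ?_
    rw [monoVal_const, ENNReal.coe_mul]; rfl
  rw [this, ENNReal.tsum_coe_ne_top_iff_summable, ← NNReal.summable_coe]
  simp

/-- Allows a separate radius for each variable; the division argument shrinks the radii of the
parameters only. -/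
theorem converges_iff_exists_wnorm_ne_top [Finite σ] (p : MvPowerSeries σ ℂ) :
    Converges p ↔ ∃ ρ : σ → ℝ≥0, (∀ i, 0 < ρ i) ∧ wnorm ρ p ≠ ⊤ := by
  constructor
  · rintro ⟨r, hr, h⟩
    lift r to ℝ≥0 using hr.le
    exact ⟨fun _ => r, fun _ => by exact_mod_cast hr, (wnorm_const_ne_top_iff r p).2 h⟩
  · rintro ⟨ρ, hρ, h⟩
    obtain ⟨r, hr0, hr⟩ : ∃ r : ℝ≥0, 0 < r ∧ ∀ i, r ≤ ρ i := by
      rcases isEmpty_or_nonempty σ with hσ | hσ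
      · exact ⟨1, one_pos, fun i => hσ.elim i⟩
      · obtain ⟨i, hi⟩ := Finite.exists_min ρ
        exact ⟨ρ i, hρ i, hi⟩
    exact ⟨r, by exact_mod_cast hr0, (wnorm_const_ne_top_iff r p).1
      (ne_top_of_le_ne_top h (wnorm_mono hr p))⟩

open scoped MvPowerSeries.WithPiTopology

/-- Contractions for a weighted norm have solvable fixed point equations. -/
theorem exists_sub_eq_of_contraction (ρ : σ → ℝ≥0) (hρ : ∀ i, 0 < ρ i)
    (T : MvPowerSeries σ ℂ →ₗ[ℂ] MvPowerSeries σ ℂ) (hT : Continuous T) (θ : ℝ≥0) (hθ : θ < 1)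
    (hTθ : ∀ p, wnorm ρ (T p) ≤ θ * wnorm ρ p) (h : MvPowerSeries σ ℂ) (hh : wnorm ρ h ≠ ⊤) :
    ∃ y, wnorm ρ y ≠ ⊤ ∧ y - T y = h := by
  -- The solution is the Neumann series `∑ T^k h`, summed coefficientwise. Continuity of `T` for the
  -- product topology then lets `T` pass through the sum.
  let a : ℕ → MvPowerSeries σ ℂ := fun k => (T ^ k) h
  have ha : ∀ k, a (k + 1) = T (a k) := fun k => by
    simp only [a, pow_succ', Module.End.mul_apply]
  have hak : ∀ k, wnorm ρ (a k) ≤ θ ^ k * wnorm ρ h := by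
    intro k
    induction k with
    | zero => simp [a]
    | succ k ih =>
      rw [ha, pow_succ', mul_assoc]
      exact (hTθ _).trans (mul_le_mul_right ih _)
  have htot : ∑' k, wnorm ρ (a k) ≠ ⊤ := by
    refine ne_top_of_le_ne_top ?_ (ENNReal.tsum_le_tsum hak)
    rw [ENNReal.tsum_mul_right, ENNReal.tsum_geometric]
    refine ENNReal.mul_ne_top (ENNReal.inv_ne_top.2 ?_) hh
    exact (tsub_pos_of_lt (by exact_mod_cast hθ)).ne'
  have hcomm : ∑' k, wnorm ρ (a k) =
      ∑' α, (∑' k, ‖MvPowerSeries.coeff α (a k)‖ₑ) * monoVal ρ α := by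
    simp only [wnorm]
    rw [ENNReal.tsum_comm]
    exact tsum_congr fun α => ENNReal.tsum_mul_right
  have hsum : ∀ α, Summable fun k => MvPowerSeries.coeff α (a k) := by
    intro α
    have h1 : (∑' k, ‖MvPowerSeries.coeff α (a k)‖ₑ) * monoVal ρ α ≠ ⊤ :=
      ne_top_of_le_ne_top (hcomm ▸ htot) (ENNReal.le_tsum (f := fun α =>
        (∑' k, ‖MvPowerSeries.coeff α (a k)‖ₑ) * (monoVal ρ α : ℝ≥0∞)) α)
    have h2 : ∑' k, ‖MvPowerSeries.coeff α (a k)‖ₑ ≠ ⊤ := by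
      intro h2
      rw [h2, ENNReal.top_mul (by exact_mod_cast (monoVal_pos hρ α).ne')] at h1
      exact h1 rfl
    exact (ENNReal.tsum_coe_ne_top_iff_summable.1 h2).of_nnnorm
  let y : MvPowerSeries σ ℂ := fun α => ∑' k, MvPowerSeries.coeff α (a k)
  have hy : HasSum a y := by
    rw [MvPowerSeries.WithPiTopology.hasSum_iff_hasSum_coeff]
    exact fun α => (hsum α).hasSum
  refine ⟨y, ?_, ?_⟩
  · refine ne_top_of_le_ne_top (hcomm ▸ htot) (ENNReal.tsum_le_tsum fun α => ?_)
    gcongr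
    exact enorm_tsum_le_tsum_enorm
  · have h1 : HasSum (fun k => a (k + 1)) (T y) := by
      simp only [ha]
      exact hy.map T hT
    rw [hasSum_nat_add_iff (f := a) 1] at h1
    have e : T y + h = y := by simpa [a] using h1.unique hy
    rw [sub_eq_iff_eq_add, add_comm, e]

/-! ### Units of the ring of germs -/

/-- Write `p = c (1 - q)` with `q(0) = 0`. On a small polydisc `q` has norm at most `1/2`, so
multiplication by `q` is a contraction and `y - q y = 1` has a convergent solution. -/
theorem isUnit_of_valueAtZero_ne_zero [Finite σ] (p : Conv σ) (hp : valueAtZero p ≠ 0) :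
    IsUnit p := by
  set c := valueAtZero p with hc
  obtain ⟨q, hq⟩ : ∃ q : MvPowerSeries σ ℂ, q = 1 - c⁻¹ • toSeries p := ⟨_, rfl⟩
  have hqc : Converges q := by
    have : toSeries (1 - c⁻¹ • p) = q := by rw [map_sub, map_one, map_smul, hq]
    rw [← this]
    exact converges_toSeries _
  have hq0 : MvPowerSeries.coeff 0 q = 0 := by
    rw [hq, map_sub, MvPowerSeries.coeff_zero_one, MvPowerSeries.coeff_smul]
    have : MvPowerSeries.coeff 0 (toSeries p) = c := by rw [hc]; rfl
    rw [this, inv_mul_cancel₀ hp, sub_self]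
  obtain ⟨ρ, hρ, hN⟩ := (converges_iff_exists_wnorm_ne_top q).1 hqc
  obtain ⟨t, ht0, ht1, htN⟩ := exists_pos_le_one_mul_le hN (δ := 1 / 2) (by norm_num)
  let ρ' : σ → ℝ≥0 := fun i => t * ρ i
  have hρ' : ∀ i, 0 < ρ' i := fun i => mul_pos ht0 (hρ i)
  have hval : ∀ α : σ →₀ ℕ, monoVal ρ' α = t ^ α.degree * monoVal ρ α := by
    intro α
    rw [← monoVal_const, monoVal, monoVal, monoVal, Finsupp.prod, Finsupp.prod, Finsupp.prod,
      ← Finset.prod_mul_distrib]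
    exact Finset.prod_congr rfl fun i _ => mul_pow _ _ _
  have hq' : wnorm ρ' q ≤ (1 / 2 : ℝ≥0) := by
    refine (wnorm_le_mul_wnorm (ρ := ρ) t q fun α hα => ?_).trans htN
    rw [hval]
    gcongr
    have : α.degree ≠ 0 := by
      intro h
      rw [Finsupp.degree_eq_zero_iff] at h
      exact hα (h ▸ hq0)
    exact pow_le_of_le_one zero_le ht1 this
  obtain ⟨y, hy, hyq⟩ := exists_sub_eq_of_contraction ρ' hρ' (LinearMap.mulLeft ℂ q)
    (continuous_const.mul continuous_id) (1 / 2) (by norm_num)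
    (fun p => (wnorm_mul_le _ _ _).trans (mul_le_mul_left hq' _)) 1
    (by simpa using wnorm_coe_ne_top ρ' (1 : MvPolynomial σ ℂ))
  have hyc : Converges y := (converges_iff_exists_wnorm_ne_top y).2 ⟨ρ', hρ', hy⟩
  obtain ⟨z, hz⟩ : ∃ z : Conv σ, toSeries z = y := ⟨⟨y, hyc⟩, rfl⟩
  refine IsUnit.of_mul_eq_one (c⁻¹ • z) (toSeries_injective ?_)
  have h2 : y - q * y = 1 := hyq
  rw [map_mul, map_smul, hz, map_one, mul_smul_comm, ← smul_mul_assoc, ← h2, hq, sub_mul, one_mul,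
    sub_sub_cancel]

end WeightedNorm

/-! ### Weierstrass division -/

section Division

open scoped NNReal ENNReal MvPowerSeries.WithPiTopology

variable {n μ : ℕ}

/-- The coordinate `i` is the first one in which the exponent `α` is at least `N`. -/
def IsFirstLarge (N : ℕ) (α : Fin n ⊕ Fin μ →₀ ℕ) (i : Fin n) : Prop :=
  N ≤ α (Sum.inl i) ∧ ∀ l < i, α (Sum.inl l) < N

open Classical in
/-- The coefficient of `x_i ^ N` in the division of a power series by the powers `x_i ^ N`. -/
def divCoeff (N : ℕ) (i : Fin n) :
    MvPowerSeries (Fin n ⊕ Fin μ) ℂ →ₗ[ℂ] MvPowerSeries (Fin n ⊕ Fin μ) ℂ where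
  toFun p := fun γ => if IsFirstLarge N (γ + Finsupp.single (Sum.inl i) N) i then
    MvPowerSeries.coeff (γ + Finsupp.single (Sum.inl i) N) p else 0
  map_add' p q := funext fun γ => by
    refine (ite_congr rfl (fun _ => map_add _ _ _) fun _ => (add_zero (0 : ℂ)).symm).trans ?_
    exact (ite_add_ite _ _ _ _ _).symm
  map_smul' c p := funext fun γ => by
    refine (ite_congr rfl (fun _ => map_smul _ _ _) fun _ => (smul_zero c).symm).trans ?_
    exact (smul_ite _ _ _ _).symm

open Classical in
theorem coeff_divCoeff (N : ℕ) (i : Fin n) (p : MvPowerSeries (Fin n ⊕ Fin μ) ℂ)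
    (γ : Fin n ⊕ Fin μ →₀ ℕ) : MvPowerSeries.coeff γ (divCoeff N i p) =
      if IsFirstLarge N (γ + Finsupp.single (Sum.inl i) N) i then
        MvPowerSeries.coeff (γ + Finsupp.single (Sum.inl i) N) p else 0 := rfl

theorem continuous_divCoeff (N : ℕ) (i : Fin n) :
    Continuous (divCoeff (μ := μ) N i) := by
  refine continuous_pi fun γ => ?_
  by_cases h : IsFirstLarge N (γ + Finsupp.single (Sum.inl i) N) i
  · refine (MvPowerSeries.WithPiTopology.continuous_coeff ℂ
      (γ + Finsupp.single (Sum.inl i) N)).congr fun p => ?_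
    exact (if_pos h).symm
  · refine (continuous_const (y := (0 : ℂ))).congr fun p => ?_
    exact (if_neg h).symm

/-- Distinct monomials stay distinct after division by `x_i ^ N`, and each loses the factor `ρ_i ^
N`. -/
theorem wnorm_divCoeff_le (N : ℕ) (i : Fin n) (ρ : Fin n ⊕ Fin μ → ℝ≥0) (hρ : ∀ i, 0 < ρ i)
    (p : MvPowerSeries (Fin n ⊕ Fin μ) ℂ) :
    wnorm ρ (divCoeff N i p) ≤ ((ρ (Sum.inl i) ^ N)⁻¹ : ℝ≥0) * wnorm ρ p := by
  have hinj : Function.Injective fun γ : Fin n ⊕ Fin μ →₀ ℕ =>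
      γ + Finsupp.single (Sum.inl i) N := add_left_injective _
  refine le_trans ?_ (mul_le_mul_right (ENNReal.tsum_comp_le_tsum_of_injective hinj _) _)
  rw [wnorm, ← ENNReal.tsum_mul_left]
  refine ENNReal.tsum_le_tsum fun γ => ?_
  rw [coeff_divCoeff, monoVal_add, monoVal_single]
  have hne : ρ (Sum.inl i) ^ N ≠ 0 := (pow_pos (hρ _) N).ne'
  have h1 : ((ρ (Sum.inl i) ^ N)⁻¹ : ℝ≥0) * (‖MvPowerSeries.coeff
      (γ + Finsupp.single (Sum.inl i) N) p‖ₑ * ((monoVal ρ γ * ρ (Sum.inl i) ^ N : ℝ≥0) : ℝ≥0∞)) =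
      ‖MvPowerSeries.coeff (γ + Finsupp.single (Sum.inl i) N) p‖ₑ * monoVal ρ γ := by
    rw [mul_left_comm, ← ENNReal.coe_mul]
    congr 2
    rw [mul_comm, mul_assoc, mul_inv_cancel₀ hne, mul_one]
  rw [h1]
  split_ifs
  · exact le_rfl
  · simp

/-- The slice of a power series given by a fixed exponent in the variables `x`. -/
def slice (α : Fin n →₀ ℕ) (p : MvPowerSeries (Fin n ⊕ Fin μ) ℂ) : MvPowerSeries (Fin μ) ℂ :=
  fun β => MvPowerSeries.coeff (Finsupp.sumElim α β) p

theorem Converges.slice {p : MvPowerSeries (Fin n ⊕ Fin μ) ℂ} (hp : Converges p)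
    (α : Fin n →₀ ℕ) : Converges (slice α p) := by
  obtain ⟨r, hr, h⟩ := hp
  refine ⟨r, hr, ?_⟩
  have hinj : Function.Injective fun β : Fin μ →₀ ℕ => Finsupp.sumElim α β := by
    intro β β' hβ
    ext j
    exact DFunLike.congr_fun hβ (Sum.inr j)
  refine ((h.comp_injective hinj).mul_right (r ^ α.degree)⁻¹).congr fun β => ?_
  have hdeg : (Finsupp.sumElim α β).degree = α.degree + β.degree := by
    simp [Finsupp.degree_eq_sum]
  have hne : r ^ α.degree ≠ 0 := (pow_pos hr _).ne'
  simp only [Function.comp_apply, hdeg, pow_add]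
  field_simp
  rfl

theorem coeff_rename_inr_mul_monomial (c : MvPowerSeries (Fin μ) ℂ) (α : Fin n →₀ ℕ)
    (γ : Fin n ⊕ Fin μ →₀ ℕ) :
    MvPowerSeries.coeff γ (MvPowerSeries.rename (Function.Embedding.inr : Fin μ ↪ Fin n ⊕ Fin μ) c *
      MvPowerSeries.monomial (Finsupp.sumElim α 0) 1) =
      if ∀ i, γ (Sum.inl i) = α i then
        MvPowerSeries.coeff (γ.comapDomain Sum.inr Sum.inr_injective.injOn) c else 0 := by
  rw [MvPowerSeries.coeff_mul_monomial, mul_one]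
  split_ifs with h1 h2 h2
  · have : γ - Finsupp.sumElim α 0 = Finsupp.embDomain Function.Embedding.inr
        (γ.comapDomain Sum.inr Sum.inr_injective.injOn) := by
      ext j
      rcases j with j | j
      · rw [Finsupp.embDomain_of_notMem_range _ _ _ (by simp)]
        simp [h2 j]
      · have := Finsupp.embDomain_apply_self (Function.Embedding.inr : Fin μ ↪ Fin n ⊕ Fin μ)
          (γ.comapDomain Sum.inr Sum.inr_injective.injOn) j
        rw [show (Sum.inr j : Fin n ⊕ Fin μ) = (Function.Embedding.inr : Fin μ ↪ Fin n ⊕ Fin μ) j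
          from rfl, this]
        simp
    rw [this, MvPowerSeries.coeff_embDomain_rename]
  · rw [MvPowerSeries.coeff_rename_eq_zero]
    rintro ⟨β, hβ⟩
    apply h2
    intro i
    have h3 := DFunLike.congr_fun hβ (Sum.inl i)
    have h4 := h1 (Sum.inl i)
    rw [← Finsupp.embDomain_eq_mapDomain, Finsupp.embDomain_of_notMem_range _ _ _ (by simp)] at h3
    simp only [Finsupp.coe_tsub, Pi.sub_apply, Finsupp.sumElim_inl] at h3 h4
    omega
  · exfalso
    apply h1
    intro j
    rcases j with j | j
    · rw [Finsupp.sumElim_inl, h2]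
    · simp [Finsupp.sumElim_inr]
  · rfl

/-- Division of power series by the powers `x_i ^ N`. -/
theorem eq_sum_slice_add_sum_divCoeff (N : ℕ) (p : MvPowerSeries (Fin n ⊕ Fin μ) ℂ) :
    p = ∑ α : Fin n → Fin N, MvPowerSeries.rename (Function.Embedding.inr : Fin μ ↪ Fin n ⊕ Fin μ)
        (slice (Finsupp.equivFunOnFinite.symm fun i => (α i : ℕ)) p) * MvPowerSeries.monomial
          (Finsupp.sumElim (Finsupp.equivFunOnFinite.symm fun i => (α i : ℕ)) 0) 1 +
      ∑ i, divCoeff N i p * MvPowerSeries.X (Sum.inl i) ^ N := by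
  classical
  ext γ
  have h1 : ∀ i, MvPowerSeries.coeff γ (divCoeff N i p * MvPowerSeries.X (Sum.inl i) ^ N) =
      if IsFirstLarge N γ i then MvPowerSeries.coeff γ p else 0 := by
    intro i
    rw [MvPowerSeries.X_pow_eq, MvPowerSeries.coeff_mul_monomial, mul_one]
    by_cases h : Finsupp.single (Sum.inl i) N ≤ γ
    · rw [if_pos h, coeff_divCoeff, tsub_add_cancel_of_le h]
    · rw [if_neg h, if_neg]
      intro h2
      exact h (Finsupp.single_le_iff.2 h2.1)
  rw [map_add, map_sum, map_sum]
  simp only [h1, coeff_rename_inr_mul_monomial]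
  by_cases hγ : ∃ i, N ≤ γ (Sum.inl i)
  · obtain ⟨i, hi, hmin⟩ : ∃ i, N ≤ γ (Sum.inl i) ∧ ∀ l < i, γ (Sum.inl l) < N := by
      let S := Finset.univ.filter fun i => N ≤ γ (Sum.inl i)
      have hS : S.Nonempty := by
        obtain ⟨i, hi⟩ := hγ
        exact ⟨i, by simp [S, hi]⟩
      refine ⟨S.min' hS, (Finset.mem_filter.1 (S.min'_mem hS)).2, fun l hl => ?_⟩
      by_contra h
      exact absurd (S.min'_le l (by simpa [S] using h)) (not_le.2 hl)
    rw [Finset.sum_eq_zero, zero_add, Finset.sum_eq_single i, if_pos ⟨hi, hmin⟩]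
    · intro j _ hj
      rw [if_neg]
      rintro ⟨h2, h3⟩
      rcases lt_or_gt_of_ne hj with h | h
      · exact absurd (hmin j h) (not_lt.2 h2)
      · exact absurd (h3 i h) (not_lt.2 hi)
    · simp
    · intro α _
      rw [if_neg]
      intro h
      have := h i
      have := (α i).2
      simp only [Finsupp.equivFunOnFinite_symm_apply_apply] at *
      omega
  · push Not at hγ
    rw [Finset.sum_eq_single fun i => ⟨γ (Sum.inl i), hγ i⟩, if_pos (fun i => by simp),
      Finset.sum_eq_zero, add_zero]
    · change _ = MvPowerSeries.coeff _ p
      congr 2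
      ext j
      rcases j with j | j <;> simp [Finsupp.sumElim_apply]
    · intro i _
      rw [if_neg]
      exact fun h => absurd h.1 (not_le.2 (hγ i))
    · intro α _ hα
      rw [if_neg]
      intro h
      apply hα
      funext i
      apply Fin.ext
      exact (h i).symm
    · simp

/-- Perturbs the division by pure powers: once `y` is split into its remainder and quotients, this
equation expresses `h` as that remainder plus `∑ divCoeff N i y * (x_i ^ N + V i)`. -/
theorem exists_add_sum_divCoeff_mul_eq (N : ℕ) (ρ : Fin n ⊕ Fin μ → ℝ≥0) (hρ : ∀ i, 0 < ρ i)
    (V : Fin n → MvPowerSeries (Fin n ⊕ Fin μ) ℂ)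
    (hV : ∑ i, ((ρ (Sum.inl i) ^ N)⁻¹ : ℝ≥0) * wnorm ρ (V i) ≤ (1 / 2 : ℝ≥0))
    (h : MvPowerSeries (Fin n ⊕ Fin μ) ℂ) (hh : wnorm ρ h ≠ ⊤) :
    ∃ y, wnorm ρ y ≠ ⊤ ∧ y + ∑ i, divCoeff N i y * V i = h := by
  let T : MvPowerSeries (Fin n ⊕ Fin μ) ℂ →ₗ[ℂ] MvPowerSeries (Fin n ⊕ Fin μ) ℂ :=
    -∑ i, (LinearMap.mulRight ℂ (V i)).comp (divCoeff N i)
  have hTp : ∀ p, T p = -∑ i, divCoeff N i p * V i := by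
    intro p
    simp [T, LinearMap.sum_apply]
  have hTc : Continuous T := by
    have : (T : MvPowerSeries (Fin n ⊕ Fin μ) ℂ → MvPowerSeries (Fin n ⊕ Fin μ) ℂ) =
        fun p => -∑ i, divCoeff N i p * V i := funext hTp
    rw [this]
    exact (continuous_finsetSum _ fun i _ =>
      (continuous_divCoeff N i).mul continuous_const).neg
  have hTn : ∀ p, wnorm ρ (T p) ≤ (1 / 2 : ℝ≥0) * wnorm ρ p := by
    intro p
    rw [hTp, wnorm_neg]
    refine (wnorm_sum_le ρ Finset.univ fun i => divCoeff N i p * V i).trans ?_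
    refine le_trans ?_ (mul_le_mul_left hV (wnorm ρ p))
    rw [Finset.sum_mul]
    refine Finset.sum_le_sum fun i _ => ?_
    refine (wnorm_mul_le ρ (divCoeff N i p) (V i)).trans ?_
    rw [mul_right_comm]
    exact mul_le_mul_left (wnorm_divCoeff_le N i ρ hρ p) _
  obtain ⟨y, hy, hyT⟩ := exists_sub_eq_of_contraction ρ hρ T hTc (1 / 2)
    (by norm_num) hTn h hh
  refine ⟨y, hy, ?_⟩
  rw [← hyT, hTp, sub_neg_eq_add]

/-- Weierstrass division by unfoldings of the powers `x_i ^ N`. -/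
theorem exists_weierstrass_division (N : ℕ) (v : Fin n → MvPolynomial (Fin n ⊕ Fin μ) ℂ)
    (hv : ∀ i, MvPolynomial.killCompl Sum.inl_injective (v i) = 0) (h : Conv (Fin n ⊕ Fin μ)) :
    ∃ (c : (Fin n → Fin N) → Conv (Fin μ)) (q : Fin n → Conv (Fin n ⊕ Fin μ)),
      h = ∑ α, pullback (Fin n) (Fin μ) (c α) *
          germ (MvPolynomial.rename Sum.inl (∏ i, MvPolynomial.X i ^ (α i : ℕ))) +
        ∑ i, q i * germ (MvPolynomial.X (Sum.inl i) ^ N + v i) := by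
  obtain ⟨ρ, hρ, hh⟩ := (converges_iff_exists_wnorm_ne_top _).1 (converges_toSeries h)
  -- Vanishing at `u = 0` means that every monomial of `v i` contains some parameter.
  have hv0 : ∀ i (α : Fin n ⊕ Fin μ →₀ ℕ), MvPolynomial.coeff α (v i) ≠ 0 →
      ∃ j, α (Sum.inr j) ≠ 0 := by
    intro i α hα
    by_contra! hcon
    apply hα
    have h1 := restrict_germ (v i)
    rw [hv, map_zero] at h1
    have h2 := congrArg toSeries h1
    rw [toSeries_restrict, toSeries_germ, map_zero] at h2
    have h3 := congrArg (MvPowerSeries.coeff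
      (α.comapDomain Sum.inl Sum.inl_injective.injOn)) h2
    rw [MvPowerSeries.coeff_killCompl, MvPolynomial.coeff_coe, MvPowerSeries.coeff_zero] at h3
    convert h3
    ext j
    rcases j with j | j
    · have := Finsupp.embDomain_apply_self (Function.Embedding.inl : Fin n ↪ Fin n ⊕ Fin μ)
          (α.comapDomain Sum.inl Sum.inl_injective.injOn) j
      rw [show (Sum.inl j : Fin n ⊕ Fin μ) = (Function.Embedding.inl : Fin n ↪ Fin n ⊕ Fin μ) j
          from rfl, this]
      rfl
    · rw [Finsupp.embDomain_of_notMem_range _ _ _ (by simp), hcon]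
  obtain ⟨B, hBdef⟩ : ∃ B : ℝ≥0∞, B = ∑ i, ((ρ (Sum.inl i) ^ N)⁻¹ : ℝ≥0)
      * wnorm ρ (v i : MvPowerSeries _ ℂ) :=
    ⟨_, rfl⟩
  have hB : B ≠ ⊤ := hBdef ▸ ENNReal.sum_ne_top.2 fun i _ =>
    ENNReal.mul_ne_top ENNReal.coe_ne_top (wnorm_coe_ne_top ρ _)
  obtain ⟨t, ht0, ht1, htB⟩ := exists_pos_le_one_mul_le hB (δ := 1 / 2) (by norm_num)
  -- Scaling only the parameter radii by `t` shrinks the norm of `v i` by at least `t`, while the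
  -- factors `ρ_i ^ (-N)` stay fixed. The choice of `t` brings the total below `1/2`.
  let ρ' : Fin n ⊕ Fin μ → ℝ≥0 := Sum.elim (fun i => ρ (Sum.inl i)) fun j => t * ρ (Sum.inr j)
  have hρ' : ∀ i, 0 < ρ' i := by
    rintro (i | j)
    · exact hρ _
    · exact mul_pos ht0 (hρ _)
  have hρρ' : ∀ i, ρ' i ≤ ρ i := by
    rintro (i | j)
    · exact le_rfl
    · exact mul_le_of_le_one_left zero_le ht1
  have hvt : ∀ i, wnorm ρ' (v i : MvPowerSeries _ ℂ) ≤ t * wnorm ρ (v i : MvPowerSeries _ ℂ) := by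
    intro i
    refine wnorm_le_mul_wnorm t _ fun α hα => ?_
    obtain ⟨j, hj⟩ := hv0 i α hα
    have hval : ∀ ρ : Fin n ⊕ Fin μ → ℝ≥0, monoVal ρ α = ρ (Sum.inr j) *
        monoVal ρ (α - Finsupp.single (Sum.inr j) 1) := by
      intro ρ
      have : α = Finsupp.single (Sum.inr j) 1 + (α - Finsupp.single (Sum.inr j) 1) := by
        rw [add_tsub_cancel_of_le]
        exact Finsupp.single_le_iff.2 (Nat.one_le_iff_ne_zero.2 hj)
      conv_lhs => rw [this]
      rw [monoVal_add, monoVal_single, pow_one]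
    rw [hval, hval, ← mul_assoc]
    gcongr
    · exact le_rfl
    · exact monoVal_mono hρρ' _
  have hρ'l : ∀ i, ρ' (Sum.inl i) = ρ (Sum.inl i) := fun i => rfl
  clear_value ρ'
  have hVt : ∑ i, ((ρ' (Sum.inl i) ^ N)⁻¹ : ℝ≥0) * wnorm ρ' (v i : MvPowerSeries _ ℂ) ≤
      (1 / 2 : ℝ≥0) := by
    refine le_trans ?_ htB
    rw [hBdef, Finset.mul_sum]
    refine Finset.sum_le_sum fun i _ => ?_
    rw [mul_left_comm, hρ'l]
    exact mul_le_mul_right (hvt i) _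
  obtain ⟨y, hy, hyT⟩ := exists_add_sum_divCoeff_mul_eq N ρ' hρ' _ hVt (toSeries h)
    (ne_top_of_le_ne_top hh (wnorm_mono hρρ' _))
  have hyc : Converges y := (converges_iff_exists_wnorm_ne_top y).2 ⟨ρ', hρ', hy⟩
  have hqc : ∀ i, Converges (divCoeff N i y) := fun i =>
    (converges_iff_exists_wnorm_ne_top _).2 ⟨ρ', hρ', ne_top_of_le_ne_top
      (ENNReal.mul_ne_top ENNReal.coe_ne_top hy) (wnorm_divCoeff_le N i ρ' hρ' y)⟩
  choose c hc using fun α : Fin n → Fin N => (show ∃ c : Conv (Fin μ), toSeries c =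
    slice (Finsupp.equivFunOnFinite.symm fun i => (α i : ℕ)) y from ⟨⟨_, hyc.slice _⟩, rfl⟩)
  choose q hq using fun i => (show ∃ q : Conv (Fin n ⊕ Fin μ), toSeries q =
    divCoeff N i y from ⟨⟨_, hqc i⟩, rfl⟩)
  refine ⟨c, q, toSeries_injective ?_⟩
  have hmon : ∀ α : Fin n → Fin N, ((MvPolynomial.rename Sum.inl
      (∏ i, (MvPolynomial.X i : MvPolynomial (Fin n) ℂ) ^ (α i : ℕ)) :
        MvPolynomial (Fin n ⊕ Fin μ) ℂ) : MvPowerSeries (Fin n ⊕ Fin μ) ℂ) =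
      MvPowerSeries.monomial
        (Finsupp.sumElim (Finsupp.equivFunOnFinite.symm fun i => (α i : ℕ)) 0) 1 := by
    intro α
    rw [← MvPolynomial.coe_monomial]
    congr 1
    rw [MvPolynomial.monomial_eq, map_prod, map_one, one_mul, Finsupp.prod_fintype _ _ (by simp)]
    simp [Finsupp.sumElim_apply]
  -- Only the free occurrence of `y` is split; its quotients then combine with the perturbation
  -- terms into multiples of `x_i ^ N + v i`.
  have hsplit := eq_sum_slice_add_sum_divCoeff N y
  rw [← hyT]
  conv_lhs => enter [1]; rw [hsplit]
  simp only [map_add, map_sum, map_mul, toSeries_germ, toSeries_pullback, hc, hq, hmon, mul_add,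
    Finset.sum_add_distrib, MvPolynomial.coe_X, map_pow]
  rw [add_assoc]

end Division

/-! ### The critical algebra is free -/

section Free

variable {n μ : ℕ}

/-- The value at the origin, as a homomorphism. -/
def valueHom (σ : Type) : Conv σ →+* ℂ := MvPowerSeries.constantCoeff.comp toSeries.toRingHom

theorem valueHom_apply {σ : Type} (p : Conv σ) : valueHom σ p = valueAtZero p := rfl

theorem valueHom_germ_X {σ : Type} (k : σ) : valueHom σ (germ (MvPolynomial.X k)) = 0 := by
  change MvPowerSeries.constantCoeff (toSeries (germ (MvPolynomial.X k : MvPolynomial σ ℂ))) = 0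
  rw [toSeries_germ, MvPolynomial.coe_X]
  exact MvPowerSeries.constantCoeff_X k

theorem ker_valueHom_le_jacobson (σ : Type) [Finite σ] :
    RingHom.ker (valueHom σ) ≤ Ideal.jacobson ⊥ := by
  intro x hx
  rw [Ideal.mem_jacobson_bot]
  intro y
  refine isUnit_of_valueAtZero_ne_zero _ ?_
  rw [← valueHom_apply, map_add, map_mul, (RingHom.mem_ker).1 hx, zero_mul, zero_add, map_one]
  exact one_ne_zero

theorem pullback_germ (p : MvPolynomial (Fin μ) ℂ) :
    pullback (Fin n) (Fin μ) (germ p) = germ (MvPolynomial.rename Sum.inr p) := by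
  apply toSeries_injective
  rw [toSeries_pullback, toSeries_germ, toSeries_germ, MvPowerSeries.rename_coe]
  rfl

theorem restrict_pullback (c : Conv (Fin μ)) :
    restrict (Fin n) (Fin μ) (pullback (Fin n) (Fin μ) c) =
      algebraMap ℂ (Conv (Fin n)) (valueAtZero c) := by
  classical
  apply toSeries_injective
  rw [toSeries_restrict, toSeries_pullback, AlgHom.commutes]
  ext α
  rw [MvPowerSeries.coeff_killCompl, MvPowerSeries.algebraMap_apply, MvPowerSeries.coeff_C]
  split_ifs with h
  · subst h
    have := MvPowerSeries.coeff_embDomain_rename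
      (Function.Embedding.inr : Fin μ ↪ Fin n ⊕ Fin μ) (toSeries c) 0
    rw [Finsupp.embDomain_zero] at this ⊢
    rw [this]
    rfl
  · rw [MvPowerSeries.coeff_rename_eq_zero]
    rintro ⟨β, hβ⟩
    apply h
    ext i
    have h1 := DFunLike.congr_fun hβ (Sum.inl i)
    rw [← Finsupp.embDomain_eq_mapDomain, Finsupp.embDomain_of_notMem_range _ _ _ (by simp)] at h1
    have h2 := Finsupp.embDomain_apply_self (Function.Embedding.inl : Fin n ↪ Fin n ⊕ Fin μ) α i
    exact h2.symm.trans h1.symm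

variable (f : MvPolynomial (Fin n) ℂ) (g : Fin μ → MvPolynomial (Fin n) ℂ)

/-- The quotient map onto the critical algebra. -/
def mkSigma : Conv (Fin n ⊕ Fin μ) →+* CriticalAlgebra f g :=
  Ideal.Quotient.mk (relJacobianIdeal f g)

theorem mkSigma_surjective : Function.Surjective (mkSigma f g) := Ideal.Quotient.mk_surjective

theorem mkSigma_eq_zero_iff (h : Conv (Fin n ⊕ Fin μ)) :
    mkSigma f g h = 0 ↔ h ∈ relJacobianIdeal f g := Ideal.Quotient.eq_zero_iff_mem

theorem algebraMap_critical (c : Conv (Fin μ)) :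
    algebraMap (Conv (Fin μ)) (CriticalAlgebra f g) c =
      mkSigma f g (pullback (Fin n) (Fin μ) c) := rfl

theorem reduction_mkSigma (h : Conv (Fin n ⊕ Fin μ)) : reduction f g (mkSigma f g h) =
    Ideal.Quotient.mk (jacobianIdeal f) (restrict (Fin n) (Fin μ) h) := rfl

theorem classSigma_eq (p : MvPolynomial (Fin n ⊕ Fin μ) ℂ) :
    classSigma f g p = mkSigma f g (germ p) := rfl

/-- The class in the critical algebra, as a homomorphism. -/
def classSigmaHom : MvPolynomial (Fin n ⊕ Fin μ) ℂ →+* CriticalAlgebra f g :=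
  (mkSigma f g).comp germ.toRingHom

theorem classSigmaHom_apply (p : MvPolynomial (Fin n ⊕ Fin μ) ℂ) :
    classSigmaHom f g p = classSigma f g p := rfl

theorem classSigmaHom_rename_inr (p : MvPolynomial (Fin μ) ℂ) :
    classSigmaHom f g (MvPolynomial.rename Sum.inr p) =
      algebraMap (Conv (Fin μ)) (CriticalAlgebra f g) (germ p) := by
  rw [algebraMap_critical, pullback_germ]; rfl

theorem classSigmaHom_X_inr (k : Fin μ) : classSigmaHom f g (MvPolynomial.X (Sum.inr k)) =
    algebraMap (Conv (Fin μ)) (CriticalAlgebra f g) (germ (MvPolynomial.X k)) := by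
  rw [← classSigmaHom_rename_inr, MvPolynomial.rename_X]

theorem classSigmaHom_C (c : ℂ) : classSigmaHom f g (MvPolynomial.C c) =
    algebraMap (Conv (Fin μ)) (CriticalAlgebra f g) (algebraMap ℂ _ c) := by
  rw [← AlgHom.commutes (germ (σ := Fin μ)) c, ← classSigmaHom_rename_inr,
      MvPolynomial.algebraMap_eq,
    MvPolynomial.rename_C]

theorem classSigmaHom_pderiv_unfolding (i : Fin n) :
    classSigmaHom f g (MvPolynomial.pderiv (Sum.inl i) (unfolding f g)) = 0 :=
  (mkSigma_eq_zero_iff f g _).2 (Ideal.subset_span ⟨i, rfl⟩)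

theorem pderiv_unfolding (i : Fin n) : MvPolynomial.pderiv (Sum.inl i) (unfolding f g) =
    MvPolynomial.rename Sum.inl (MvPolynomial.pderiv i f) +
      ∑ k, MvPolynomial.X (Sum.inr k) * MvPolynomial.rename Sum.inl (MvPolynomial.pderiv i
          (g k)) := by
  simp [unfolding, MvPolynomial.pderiv_rename Sum.inl_injective, MvPolynomial.pderiv_X, mul_comm]

theorem reduction_smul (c : Conv (Fin μ)) (x : CriticalAlgebra f g) :
    reduction f g (c • x) = valueAtZero c • reduction f g x := by
  rw [Algebra.smul_def, map_mul, algebraMap_critical, reduction_mkSigma, restrict_pullback,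
    Algebra.smul_def]
  rfl

theorem reduction_classSigma_rename (p : MvPolynomial (Fin n) ℂ) :
    reduction f g (classSigma f g (MvPolynomial.rename Sum.inl p)) = classM f p := by
  rw [classSigma_eq, reduction_mkSigma, restrict_germ, MvPolynomial.killCompl_rename_app]
  rfl

theorem linearIndependent_classSigma
    (hker : ∀ p, classHom f p = 0 ↔ p ∈ Ideal.span (Set.range fun i => MvPolynomial.pderiv i f))
    (N : ℕ) (hN : ∀ i, classHom f (MvPolynomial.X i) ^ (N + 1) = 0)
    (hli : LinearIndependent ℂ fun k => classM f (g k)) :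
    LinearIndependent (Conv (Fin μ)) fun k =>
      classSigma f g (MvPolynomial.rename Sum.inl (g k)) := by
  rw [Fintype.linearIndependent_iff]
  intro c hc k
  refine eq_zero_of_sum_pullback_mul_germ_mem
    (fun i => MvPolynomial.pderiv (Sum.inl i) (unfolding f g))
    (fun i => MvPolynomial.pderiv i f) (killCompl_pderiv_unfolding f g)
    (fun i => ⟨N + 1, (hker _).1 ((map_pow _ _ _).trans (hN i))⟩) g (classHom f)
    (fun i => (hker _).2 (Ideal.subset_span ⟨i, rfl⟩)) hli c ?_ k
  refine (mkSigma_eq_zero_iff f g _).1 ?_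
  rw [map_sum, ← hc]
  exact Finset.sum_congr rfl fun k _ => by
    rw [map_mul, Algebra.smul_def, algebraMap_critical, classSigma_eq]

/-- Replace `∂f/∂x_j` by `∂F/∂x_j` in an expression of `X_i ^ (N + 1)` through the partial
derivatives of `f`. The result is zero in `O_Σ` and differs from `X_i ^ (N + 1)` by a polynomial
vanishing at `u = 0`, so Weierstrass division applies. -/
theorem span_monomials_eq_top
    (hker : ∀ p, classHom f p = 0 ↔ p ∈ Ideal.span (Set.range fun i => MvPolynomial.pderiv i f))
    (N : ℕ) (hN : ∀ i, classHom f (MvPolynomial.X i) ^ (N + 1) = 0) :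
    Submodule.span (Conv (Fin μ)) (Set.range fun α : Fin n → Fin (N + 1) =>
      classSigmaHom f g (MvPolynomial.rename Sum.inl (∏ i, MvPolynomial.X i ^ (α i : ℕ)))) = ⊤ := by
  choose a ha using fun i => (Ideal.mem_span_range_iff_exists_fun).1
    ((hker _).1 ((map_pow (classHom f) (MvPolynomial.X i) (N + 1)).trans (hN i)))
  let E : Fin n → MvPolynomial (Fin n ⊕ Fin μ) ℂ := fun i =>
    ∑ j, MvPolynomial.rename Sum.inl (a i j) * MvPolynomial.pderiv (Sum.inl j) (unfolding f g)
  have hE : ∀ i, classSigmaHom f g (E i) = 0 := by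
    intro i
    simp only [E, map_sum, map_mul, classSigmaHom_pderiv_unfolding, mul_zero,
      Finset.sum_const_zero]
  let v : Fin n → MvPolynomial (Fin n ⊕ Fin μ) ℂ := fun i =>
    E i - MvPolynomial.X (Sum.inl i) ^ (N + 1)
  have hv : ∀ i, MvPolynomial.killCompl Sum.inl_injective (v i) = 0 := by
    intro i
    simp only [v, E, map_sub, map_sum, map_mul, killCompl_pderiv_unfolding,
      MvPolynomial.killCompl_rename_app, ha]
    rw [← MvPolynomial.rename_X (R := ℂ) Sum.inl i, ← map_pow, MvPolynomial.killCompl_rename_app,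
      sub_self]
  rw [eq_top_iff]
  rintro x -
  obtain ⟨h, rfl⟩ := mkSigma_surjective f g x
  obtain ⟨c, q, hcq⟩ := exists_weierstrass_division (N + 1) v hv h
  rw [hcq, map_add, map_sum, map_sum, Finset.sum_eq_zero (s := Finset.univ) (f := fun i =>
    mkSigma f g (q i * germ (MvPolynomial.X (Sum.inl i) ^ (N + 1) + v i))), add_zero]
  · refine sum_mem fun α _ => ?_
    rw [map_mul, ← algebraMap_critical, ← Algebra.smul_def]
    exact Submodule.smul_mem _ _ (Submodule.subset_span ⟨α, rfl⟩)
  · intro i _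
    rw [map_mul, add_sub_cancel]
    exact mul_eq_zero_of_right _ (hE i)

/-- Nakayama's lemma, with finiteness supplied by the monomials. A polynomial in `x` is a
combination of the `g k` modulo the `∂f/∂x_i`, and in `O_Σ` each `∂f/∂x_i` equals `-∑ u_k
∂g_k/∂x_i`, which lies in `m_S O_Σ`. -/
theorem span_classSigma_eq_top
    (hker : ∀ p, classHom f p = 0 ↔ p ∈ Ideal.span (Set.range fun i => MvPolynomial.pderiv i f))
    (N : ℕ) (hN : ∀ i, classHom f (MvPolynomial.X i) ^ (N + 1) = 0)
    (hspan : Submodule.span ℂ (Set.range fun k => classM f (g k)) = ⊤) :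
    Submodule.span (Conv (Fin μ)) (Set.range fun k =>
      classSigma f g (MvPolynomial.rename Sum.inl (g k))) = ⊤ := by
  have hmon := span_monomials_eq_top f g hker N hN
  set S := Submodule.span (Conv (Fin μ)) (Set.range fun k =>
      classSigma f g (MvPolynomial.rename Sum.inl (g k))) with hS
  have hfg : (⊤ : Submodule (Conv (Fin μ)) (CriticalAlgebra f g)).FG := by
    rw [← hmon]
    exact Submodule.fg_span (Set.finite_range _)
  rw [eq_top_iff]
  refine Submodule.le_of_le_smul_of_le_jacobson_bot hfg (ker_valueHom_le_jacobson (Fin μ)) ?_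
  have hpoly : ∀ p : MvPolynomial (Fin n) ℂ, classSigmaHom f g (MvPolynomial.rename Sum.inl p) ∈
      S ⊔ RingHom.ker (valueHom (Fin μ)) •
        (⊤ : Submodule (Conv (Fin μ)) (CriticalAlgebra f g)) := by
    intro p
    have h1 : classHom f p ∈ Submodule.span ℂ (Set.range fun k => classM f (g k)) := by
      rw [hspan]; trivial
    obtain ⟨c, hc⟩ := (Submodule.mem_span_range_iff_exists_fun ℂ).1 h1
    have h2 : classHom f (p - ∑ k, c k • g k) = 0 := by
      rw [map_sub, map_sum, ← hc, sub_eq_zero]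
      exact Finset.sum_congr rfl fun k _ => (map_smul (classHom f) _ _).symm
    obtain ⟨a, ha⟩ := (Ideal.mem_span_range_iff_exists_fun).1 ((hker _).1 h2)
    have h3 : classSigmaHom f g (MvPolynomial.rename Sum.inl p) =
        ∑ k, algebraMap ℂ (Conv (Fin μ)) (c k) •
          classSigma f g (MvPolynomial.rename Sum.inl (g k)) +
        -∑ i, ∑ k, germ (MvPolynomial.X k) • classSigmaHom f g
          (MvPolynomial.rename Sum.inl (a i * MvPolynomial.pderiv i (g k))) := by
      have h4 : p = ∑ k, MvPolynomial.C (c k) * g k + ∑ i, a i * MvPolynomial.pderiv i f := by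
        rw [ha]
        simp only [MvPolynomial.smul_eq_C_mul]
        ring
      have h5 : ∀ i, classSigmaHom f g (MvPolynomial.rename Sum.inl (MvPolynomial.pderiv i f)) =
          -∑ k, germ (MvPolynomial.X k) • classSigmaHom f g
            (MvPolynomial.rename Sum.inl (MvPolynomial.pderiv i (g k))) := by
        intro i
        have := classSigmaHom_pderiv_unfolding f g i
        rw [pderiv_unfolding, map_add] at this
        rw [eq_neg_of_add_eq_zero_left this, map_sum]
        congr 1
        exact Finset.sum_congr rfl fun k _ => by
          rw [map_mul, classSigmaHom_X_inr, Algebra.smul_def]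
      conv_lhs => rw [h4]
      simp only [map_add, map_sum, map_mul, MvPolynomial.rename_C, classSigmaHom_C, h5,
        Algebra.smul_def, mul_neg, Finset.mul_sum, Finset.sum_neg_distrib, ← classSigmaHom_apply]
      congr 2
      exact Finset.sum_congr rfl fun i _ => Finset.sum_congr rfl fun k _ => by ring
    rw [h3]
    refine Submodule.add_mem_sup (sum_mem fun k _ => S.smul_mem _ (Submodule.subset_span ⟨k, rfl⟩))
      (neg_mem (sum_mem fun i _ => sum_mem fun k _ => ?_))
    exact Submodule.smul_mem_smul (valueHom_germ_X k) Submodule.mem_top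
  conv_lhs => rw [← hmon]
  rw [Submodule.span_le]
  rintro _ ⟨α, rfl⟩
  exact hpoly _

end Free

/-! ### Generators of the dual module -/

section Dual

variable {R A ι : Type} [CommRing R] [CommRing A] [Algebra R A] [DecidableEq ι]

theorem repr_eq_of_dual (b : Module.Basis ι R A) (Φ : A →ₗ[R] R) (a : ι → A)
    (ha : ∀ i j, Φ (b i * a j) = if i = j then 1 else 0) (x : A) (i : ι) :
    b.repr x i = Φ (a i * x) := by
  suffices b.coord i = Φ.comp (LinearMap.mulLeft R (a i)) from DFunLike.congr_fun this x
  refine b.ext fun k => ?_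
  simp [mul_comm (a i), ha, Finsupp.single_apply]

variable [Fintype ι]

theorem generatesDual_of_isUnit_det (b : Module.Basis ι R A) (φ : A →ₗ[R] R)
    (h : IsUnit (Matrix.of fun i j => φ (b i * b j)).det) : GeneratesDual φ := by
  set G := Matrix.of fun i j => φ (b i * b j) with hG
  intro ψ
  let x := Matrix.vecMul (fun i => ψ (b i)) G⁻¹
  refine ⟨∑ j, x j • b j, fun y => ?_⟩
  suffices ψ = φ.comp (LinearMap.mulLeft R (∑ j, x j • b j)) from DFunLike.congr_fun this y
  refine b.ext fun i => ?_
  have h1 : Matrix.vecMul x G = fun i => ψ (b i) := by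
    rw [Matrix.vecMul_vecMul, Matrix.nonsing_inv_mul _ h, Matrix.vecMul_one]
  rw [← congrFun h1 i]
  simp [Matrix.vecMul, dotProduct, hG, Finset.sum_mul]

/-- The dual vectors `a i` represent the coordinate forms of `b`. For spanning, the defect `y = x -
∑ Φ(b_k x) a_k` pairs to zero with every `b i`, hence with everything, and its coordinates are the
pairings `Φ(a_i y)`. -/
theorem exists_dual_basis (b : Module.Basis ι R A) (Φ : A →ₗ[R] R) (hΦ : GeneratesDual Φ) :
    ∃ b' : Module.Basis ι R A, ∀ i j, Φ (b i * b' j) = if i = j then 1 else 0 := by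
  choose a ha using fun i => hΦ (b.coord i)
  have hdual : ∀ i j, Φ (b i * a j) = if i = j then 1 else 0 := by
    intro i j
    rw [mul_comm, ← ha]
    simp [Finsupp.single_apply]
  have hli : LinearIndependent R a := by
    rw [Fintype.linearIndependent_iff]
    intro c hc k
    have := congrArg (fun y => Φ (b k * y)) hc
    simpa [Finset.mul_sum, hdual] using this
  have hspan : ⊤ ≤ Submodule.span R (Set.range a) := by
    rintro x -
    have hx : x = ∑ k, Φ (b k * x) • a k := by
      rw [← sub_eq_zero]
      set y := x - ∑ k, Φ (b k * x) • a k with hy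
      have h1 : Φ.comp (LinearMap.mulLeft R y) = 0 := by
        refine b.ext fun i => ?_
        simp [hy, mul_comm _ (b i), mul_sub, Finset.mul_sum, hdual]
      refine b.ext_elem fun i => ?_
      rw [repr_eq_of_dual b Φ a hdual, mul_comm]
      simpa using DFunLike.congr_fun h1 (a i)
    rw [hx]
    exact sum_mem fun k _ => Submodule.smul_mem _ _ (Submodule.subset_span ⟨k, rfl⟩)
  exact ⟨Module.Basis.mk hli hspan, fun i j => by rw [Module.Basis.mk_apply, hdual]⟩

end Dual

/-! ### The socle of the Jacobian algebra -/

section Socle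

variable {n μ : ℕ}

theorem classHom_surjective (f : MvPolynomial (Fin n) ℂ) (g : Fin μ → MvPolynomial (Fin n) ℂ)
    (hspan : Submodule.span ℂ (Set.range fun k => classM f (g k)) = ⊤) :
    Function.Surjective (classHom f) := by
  intro h
  have h1 : h ∈ Submodule.span ℂ (Set.range fun k => classM f (g k)) := by
    rw [hspan]; trivial
  obtain ⟨c, rfl⟩ := (Submodule.mem_span_range_iff_exists_fun ℂ).1 h1
  refine ⟨∑ k, c k • g k, ?_⟩
  rw [map_sum]
  exact Finset.sum_congr rfl fun k _ => map_smul (classHom f) _ _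

theorem isNilpotent_classHom_sub_constantCoeff (f : MvPolynomial (Fin n) ℂ) (N : ℕ)
    (hN : ∀ i, classHom f (MvPolynomial.X i) ^ (N + 1) = 0) (p : MvPolynomial (Fin n) ℂ) :
    IsNilpotent (classHom f p - algebraMap ℂ _ (MvPolynomial.constantCoeff p)) := by
  induction p using MvPolynomial.induction_on with
  | C a =>
    rw [MvPolynomial.constantCoeff_C, ← MvPolynomial.algebraMap_eq, AlgHom.commutes, sub_self]
    exact IsNilpotent.zero
  | add p q hp hq =>
    rw [map_add, map_add, map_add, add_sub_add_comm]
    exact (Commute.all _ _).isNilpotent_add hp hq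
  | mul_X p i _ =>
    rw [map_mul, map_mul, MvPolynomial.constantCoeff_X, mul_zero, map_zero, sub_zero]
    exact (Commute.all _ _).isNilpotent_mul_left ⟨N + 1, hN i⟩

/-- The Hessian spans the socle of the Jacobian algebra, and a linear form which does not vanish
on the socle defines a nondegenerate pairing. -/
theorem hessian_eq_smul_and_nondegenerate (w : Fin n → ℚ) (hw : ∀ i, 0 < w i) (d : ℚ)
    (f : MvPolynomial (Fin n) ℂ) (hf : MvPolynomial.IsWeightedHomogeneous w f d)
    (g : Fin μ → MvPolynomial (Fin n) ℂ) (e : Fin μ → ℚ)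
    (hg : ∀ k, MvPolynomial.IsWeightedHomogeneous w (g k) (e k))
    (hli : LinearIndependent ℂ fun k => classM f (g k))
    (hspan : Submodule.span ℂ (Set.range fun k => classM f (g k)) = ⊤)
    (j : Fin μ) (hj : ∀ k, e k ≤ e j) :
    (∃ c : ℂ, c ≠ 0 ∧ classM f (hessian f) = c • classM f (g j)) ∧
      ∀ ψ : JacobianAlgebra f →ₗ[ℂ] ℂ, ψ (classM f (g j)) ≠ 0 →
        ∀ a, (∀ b, ψ (a * b) = 0) → a = 0 := by
  obtain ⟨N, hN⟩ := classHom_X_pow_eq_zero w hw d f hf g e hg hspan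
  have hsurj := classHom_surjective f g hspan
  have : FiniteDimensional ℂ (JacobianAlgebra f) :=
    ⟨by rw [← hspan]; exact Submodule.fg_span (Set.finite_range _)⟩
  have : Nontrivial (JacobianAlgebra f) := ⟨_, 0, hli.ne_zero j⟩
  -- The residue of the gradient of `f` over `ℂ`; its Jacobian determinant is the Hessian.
  obtain ⟨φ, s, p, q, hpq, hJ⟩ := exists_residue (classHom f) hsurj
    (fun i => MvPolynomial.pderiv i f) (classHom_eq_zero_iff w hw d f hf) N hN
  have h := jacobian_eq_smul_socle φ p q hpq ?_ (classM f (g j)) (hli.ne_zero j) ?_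
  · rw [hJ] at h
    exact h
  · intro h
    obtain ⟨p, rfl⟩ := hsurj h
    exact ⟨_, isNilpotent_classHom_sub_constantCoeff f N hN p⟩
  · intro h hh
    obtain ⟨p, rfl⟩ := hsurj h
    -- The constant term is a difference of two nilpotents, and a nilpotent scalar in a nontrivial
    -- algebra is zero.
    have h0 : MvPolynomial.constantCoeff p = 0 := by
      have h1 := (Commute.all _ _).isNilpotent_sub hh
        (isNilpotent_classHom_sub_constantCoeff f N hN p)
      rw [sub_sub_cancel] at h1
      exact (IsNilpotent.map_iff (algebraMap ℂ (JacobianAlgebra f)).injective).1 h1 |>.eq_zero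
    have h2 := mul_classHom_eq_zero_of_isNilpotent w hw d f hf g e hg hspan j hj p
    rwa [h0, map_zero, sub_zero] at h2

end Socle

/-! ### The Euler relation -/

section Euler

variable {n μ : ℕ}

theorem sum_weight_mul_X_mul_pderiv {σ : Type*} [Fintype σ] (w : σ → ℚ) (D : ℚ)
    (p : MvPolynomial σ ℂ) (hp : MvPolynomial.IsWeightedHomogeneous w p D) :
    ∑ i, MvPolynomial.C (w i : ℂ) * (MvPolynomial.X i * MvPolynomial.pderiv i p) =
      MvPolynomial.C (D : ℂ) * p := by
  classical
  have hmon : ∀ α ∈ p.support,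
      ∑ i, MvPolynomial.C (w i : ℂ) * (MvPolynomial.X i * MvPolynomial.pderiv i
        (MvPolynomial.monomial α (p.coeff α))) =
      MvPolynomial.C (D : ℂ) * MvPolynomial.monomial α (p.coeff α) := by
    intro α hα
    have hα' : (D : ℂ) = ∑ i, (α i : ℂ) * w i := by
      rw [← hp (MvPolynomial.mem_support_iff.1 hα), Finsupp.weight_apply,
        Finsupp.sum_fintype _ _ (by simp)]
      push_cast
      simp
    rw [hα', map_sum, Finset.sum_mul]
    refine Finset.sum_congr rfl fun i _ => ?_
    rw [MvPolynomial.X_mul_pderiv_monomial, nsmul_eq_mul, ← map_natCast MvPolynomial.C, ← mul_assoc,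
      ← MvPolynomial.C_mul, mul_comm (w i : ℂ)]
  conv_lhs => rw [p.as_sum]
  conv_rhs => rw [p.as_sum]
  simp only [map_sum, Finset.mul_sum]
  rw [Finset.sum_comm]
  refine Finset.sum_congr rfl fun α hα => ?_
  rw [hmon α hα]

variable (f : MvPolynomial (Fin n) ℂ) (g : Fin μ → MvPolynomial (Fin n) ℂ)

/-- The Euler field in `x` multiplies `f` by `d` and `g k * u_k` by `e k`; the defect `d - e k` is
the weight of `u_k` that makes `F` homogeneous of degree `d`. -/
theorem euler_unfolding (w : Fin n → ℚ) (d : ℚ) (hf : MvPolynomial.IsWeightedHomogeneous w f d)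
    (e : Fin μ → ℚ) (hg : ∀ k, MvPolynomial.IsWeightedHomogeneous w (g k) (e k)) :
    MvPolynomial.C (d : ℂ) * unfolding f g =
      ∑ i, MvPolynomial.C (w i : ℂ) * MvPolynomial.X (Sum.inl i) *
          MvPolynomial.pderiv (Sum.inl i) (unfolding f g) +
        ∑ k, MvPolynomial.C ((d - e k : ℚ) : ℂ) *
          (MvPolynomial.rename Sum.inl (g k) * MvPolynomial.X (Sum.inr k)) := by
  have h1 := congrArg (MvPolynomial.rename (Sum.inl : Fin n → Fin n ⊕ Fin μ))
    (sum_weight_mul_X_mul_pderiv w d f hf)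
  have h2 := fun k => congrArg (MvPolynomial.rename (Sum.inl : Fin n → Fin n ⊕ Fin μ))
    (sum_weight_mul_X_mul_pderiv w (e k) (g k) (hg k))
  simp only [map_sum, map_mul, MvPolynomial.rename_C, MvPolynomial.rename_X] at h1 h2
  simp only [pderiv_unfolding, mul_add, Finset.sum_add_distrib, Finset.mul_sum]
  rw [Finset.sum_comm (s := Finset.univ (α := Fin n))]
  simp only [mul_assoc]
  rw [h1, unfolding, mul_add, add_assoc, ← Finset.sum_add_distrib, Finset.mul_sum]
  congr 1
  refine Finset.sum_congr rfl fun k _ => ?_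
  have h3 : ∀ i, MvPolynomial.C (w i : ℂ) * (MvPolynomial.X (Sum.inl i) *
      (MvPolynomial.X (Sum.inr k) * MvPolynomial.rename Sum.inl (MvPolynomial.pderiv i (g k)))) =
      MvPolynomial.X (Sum.inr k) * (MvPolynomial.C (w i : ℂ) * (MvPolynomial.X (Sum.inl i) *
        MvPolynomial.rename Sum.inl (MvPolynomial.pderiv i (g k)))) := fun i => by ring
  simp only [h3]
  rw [← Finset.mul_sum, h2]
  push_cast
  rw [map_sub]
  ring

theorem algebraMap_smul_classSigma_unfolding (w : Fin n → ℚ) (d : ℚ)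
    (hf : MvPolynomial.IsWeightedHomogeneous w f d) (e : Fin μ → ℚ)
    (hg : ∀ k, MvPolynomial.IsWeightedHomogeneous w (g k) (e k)) :
    algebraMap ℂ (Conv (Fin μ)) d • classSigma f g (unfolding f g) =
      ∑ k, (algebraMap ℂ (Conv (Fin μ)) ((d - e k : ℚ) : ℂ) * germ (MvPolynomial.X k)) •
        classSigma f g (MvPolynomial.rename Sum.inl (g k)) := by
  have h := congrArg (classSigmaHom f g) (euler_unfolding f g w d hf e hg)
  simp only [map_add, map_sum, map_mul, classSigmaHom_pderiv_unfolding, mul_zero,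
    Finset.sum_const_zero, zero_add, classSigmaHom_C, classSigmaHom_X_inr] at h
  rw [Algebra.smul_def]
  refine h.trans (Finset.sum_congr rfl fun k _ => ?_)
  rw [Algebra.smul_def, map_mul, mul_assoc, mul_comm (classSigmaHom f g _)]
  rfl

end Euler

/-! ### Linear parts -/

section LinearPart

variable {σ : Type} [Fintype σ]

theorem linearPart_smul (c : ℂ) (p : Conv σ) : linearPart (c • p) = c • linearPart p := by
  simp [linearPart, MvPolynomial.smul_eq_C_mul, Finset.mul_sum, mul_assoc]

theorem linearPart_add (p q : Conv σ) : linearPart (p + q) = linearPart p + linearPart q := by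
  simp [linearPart, add_mul, Finset.sum_add_distrib]

theorem linearPart_sum {ι : Type*} (s : Finset ι) (p : ι → Conv σ) :
    linearPart (∑ i ∈ s, p i) = ∑ i ∈ s, linearPart (p i) := by
  classical
  induction s using Finset.induction_on with
  | empty => simp [linearPart]
  | insert i s hi ih => rw [Finset.sum_insert hi, Finset.sum_insert hi, linearPart_add, ih]

theorem linearPart_mul_germ_X (p : Conv σ) (k : σ) :
    linearPart (p * germ (MvPolynomial.X k)) = valueAtZero p • MvPolynomial.X k := by
  classical
  rw [linearPart, Finset.sum_eq_single k]
  · rw [map_mul, toSeries_germ, MvPolynomial.coe_X, MvPolynomial.smul_eq_C_mul]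
    have := MvPowerSeries.coeff_add_mul_monomial 0 (Finsupp.single k 1) (toSeries p) (1 : ℂ)
    rw [zero_add, mul_one] at this
    rw [MvPowerSeries.X, this]
    rfl
  · intro l _ hl
    rw [map_mul, toSeries_germ, MvPolynomial.coe_X, MvPowerSeries.X,
      MvPowerSeries.coeff_mul_monomial, if_neg, map_zero, zero_mul]
    intro h
    have := h k
    simp [hl] at this
  · simp

end LinearPart

/-! ### Bases of the critical algebra and of the Jacobian algebra -/

section Bases

variable {n μ : ℕ} (f : MvPolynomial (Fin n) ℂ) (g : Fin μ → MvPolynomial (Fin n) ℂ)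
  (b : Module.Basis (Fin μ) (Conv (Fin μ)) (CriticalAlgebra f g))

theorem reduction_basis (hb : ∀ k, b k = classSigma f g (MvPolynomial.rename Sum.inl (g k)))
    (k : Fin μ) : reduction f g (b k) = classM f (g k) := by
  rw [hb, reduction_classSigma_rename]

/-- The linear form induced on the Jacobian algebra by a linear form on the critical algebra. -/
def inducedForm (bM : Module.Basis (Fin μ) ℂ (JacobianAlgebra f))
    (Φ : CriticalAlgebra f g →ₗ[Conv (Fin μ)] Conv (Fin μ)) : JacobianAlgebra f →ₗ[ℂ] ℂ :=
  bM.constr ℂ fun k => valueAtZero (Φ (b k))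

theorem inducedForm_reduction (bM : Module.Basis (Fin μ) ℂ (JacobianAlgebra f))
    (hbM : ∀ k, reduction f g (b k) = bM k)
    (Φ : CriticalAlgebra f g →ₗ[Conv (Fin μ)] Conv (Fin μ)) (h : CriticalAlgebra f g) :
    inducedForm f g b bM Φ (reduction f g h) = valueAtZero (Φ h) := by
  rw [← b.sum_repr h]
  simp only [map_sum, reduction_smul, hbM, map_smul, smul_eq_mul, inducedForm,
    Module.Basis.constr_basis]
  rw [← valueHom_apply, map_sum]
  exact Finset.sum_congr rfl fun k _ => (map_mul (valueHom (Fin μ)) _ _).symm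

/-- A linear form on the critical algebra generates the dual if the induced form on the Jacobian
algebra defines a nondegenerate pairing. -/
theorem generatesDual_of_nondegenerate (bM : Module.Basis (Fin μ) ℂ (JacobianAlgebra f))
    (hbM : ∀ k, reduction f g (b k) = bM k)
    (Φ : CriticalAlgebra f g →ₗ[Conv (Fin μ)] Conv (Fin μ))
    (hnd : ∀ x, (∀ y, inducedForm f g b bM Φ (x * y) = 0) → x = 0) : GeneratesDual Φ := by
  -- Because germs with nonzero value are units, it suffices that the Gram determinant is nonzero at
  -- `u = 0`, where the matrix is that of the induced pairing on `M_f`.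
  refine generatesDual_of_isUnit_det b Φ (isUnit_of_valueAtZero_ne_zero _ ?_)
  rw [← valueHom_apply, RingHom.map_det]
  intro hdet
  obtain ⟨v, hv, hGv⟩ := Matrix.exists_mulVec_eq_zero_iff.2 hdet
  have hx : ∑ j, v j • bM j = 0 := by
    refine hnd _ fun y => ?_
    have : (inducedForm f g b bM Φ).comp (LinearMap.mulLeft ℂ (∑ j, v j • bM j)) = 0 := by
      refine bM.ext fun i => ?_
      have h := congrFun hGv i
      simp only [Matrix.mulVec, dotProduct, RingHom.mapMatrix_apply, Matrix.map_apply,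
        Matrix.of_apply, valueHom_apply, ← inducedForm_reduction f g b bM hbM, map_mul, hbM] at h
      simpa [Finset.mul_sum, mul_comm _ (bM i), mul_comm (v _)] using h
    exact DFunLike.congr_fun this y
  exact hv (funext fun j => Fintype.linearIndependent_iff.1 bM.linearIndependent v hx j)

theorem generatesDual_smul {R A : Type} [CommRing R] [CommRing A] [Algebra R A] (Φ : A →ₗ[R] R)
    (hΦ : GeneratesDual Φ) (u : Rˣ) : GeneratesDual ((u : R) • Φ) := by
  intro φ
  obtain ⟨a, ha⟩ := hΦ φ
  refine ⟨((u⁻¹ : Rˣ) : R) • a, fun h => ?_⟩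
  rw [ha, LinearMap.smul_apply, smul_mul_assoc, map_smul, smul_smul, Units.mul_inv, one_smul]

/-- Coordinates in `b` are pairings with the dual basis, which turns the matrix entry into an
expression symmetric in `i` and `j`. -/
theorem multiplicationMatrix_apply (b' : Module.Basis (Fin μ) (Conv (Fin μ)) (CriticalAlgebra f g))
    (Φ : CriticalAlgebra f g →ₗ[Conv (Fin μ)] Conv (Fin μ))
    (hb' : ∀ i j, Φ (b i * b' j) = if i = j then 1 else 0) (i j : Fin μ) :
    multiplicationMatrix f g b' b i j = Φ (b' i * b' j * classSigma f g (unfolding f g)) := by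
  rw [multiplicationMatrix, LinearMap.toMatrix_apply, repr_eq_of_dual b Φ b' hb',
    LinearMap.mulLeft_apply, mul_assoc, mul_comm (b' j)]

theorem smul_multiplicationMatrix_apply
    (b' : Module.Basis (Fin μ) (Conv (Fin μ)) (CriticalAlgebra f g))
    (Φ : CriticalAlgebra f g →ₗ[Conv (Fin μ)] Conv (Fin μ))
    (hb' : ∀ i j, Φ (b i * b' j) = if i = j then 1 else 0)
    (hb : ∀ k, b k = classSigma f g (MvPolynomial.rename Sum.inl (g k)))
    (w : Fin n → ℚ) (d : ℚ) (hf : MvPolynomial.IsWeightedHomogeneous w f d) (e : Fin μ → ℚ)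
    (hg : ∀ k, MvPolynomial.IsWeightedHomogeneous w (g k) (e k)) (i j : Fin μ) :
    (d : ℂ) • multiplicationMatrix f g b' b i j =
      ∑ k, ((d - e k : ℚ) : ℂ) • (pairing Φ (b' i * b' j) (b k) * germ (MvPolynomial.X k)) := by
  rw [multiplicationMatrix_apply f g b b' Φ hb', Algebra.smul_def, ← smul_eq_mul, ← map_smul,
    ← mul_smul_comm, algebraMap_smul_classSigma_unfolding f g w d hf e hg, Finset.mul_sum, map_sum]
  refine Finset.sum_congr rfl fun k _ => ?_
  rw [← hb, mul_smul_comm, map_smul, smul_eq_mul, Algebra.smul_def, pairing]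
  ring

end Bases

end WHSing

end

open WHSing in
theorem theorem3p3 (n m : ℕ)
    -- positive weights of the coordinates, and the weighted homogeneous function `f` of degree `d`
    (w : Fin n → ℚ) (hw : ∀ i, 0 < w i) (d : ℚ) (hd : 0 < d)
    (f : MvPolynomial (Fin n) ℂ) (hf : MvPolynomial.IsWeightedHomogeneous w f d)
    (hcrit : HasIsolatedCriticalPoint f)
    -- a weighted homogeneous basis of the Jacobian algebra, of decreasing degrees `e k`;
    -- the Milnor number is `μ = m + 1`
    (g : Fin (m + 1) → MvPolynomial (Fin n) ℂ) (e : Fin (m + 1) → ℚ)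
    (hg : ∀ k, MvPolynomial.IsWeightedHomogeneous w (g k) (e k))
    (he : Antitone e) (hlast : g (Fin.last m) = 1)
    (hli : LinearIndependent ℂ fun k => classM f (g k))
    (hspan : Submodule.span ℂ (Set.range fun k => classM f (g k)) = ⊤) :
    -- `O_Σ` is free over `O_S` with basis `g`
    ∃ b : Module.Basis (Fin (m + 1)) (Conv (Fin (m + 1))) (CriticalAlgebra f g),
      (∀ k, b k = classSigma f g (MvPolynomial.rename Sum.inl (g k))) ∧
      -- the coefficient of the Hessian, in the basis `g`, generates `Hom(O_Σ, O_S)`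
      (∃ c : ℂ, c ≠ 0 ∧ classM f (hessian f) = c • classM f (g 0) ∧
        GeneratesDual (c⁻¹ • b.coord 0)) ∧
      -- for each generator there is a dual basis `g'`, and an induced form `Φ₀` on `M_f`
      ∀ Φ : CriticalAlgebra f g →ₗ[Conv (Fin (m + 1))] Conv (Fin (m + 1)), GeneratesDual Φ →
        ∃ g' : Module.Basis (Fin (m + 1)) (Conv (Fin (m + 1))) (CriticalAlgebra f g),
          (∀ i j, pairing Φ (b i) (g' j) = if i = j then 1 else 0) ∧
          ∃ Φ₀ : JacobianAlgebra f →ₗ[ℂ] ℂ,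
            (∀ h, Φ₀ (reduction f g h) = valueAtZero (Φ h)) ∧
            (multiplicationMatrix f g g' b).IsSymm ∧
            ∀ i j,
              (d : ℂ) • multiplicationMatrix f g g' b i j =
                ∑ k, ((d - e k : ℚ) : ℂ) • (pairing Φ (g' i * g' j) (b k) *
                  germ (MvPolynomial.X k)) ∧
              (d : ℂ) • linearPart (multiplicationMatrix f g g' b i j) =
                ∑ k, (((d - e k : ℚ) : ℂ) *
                  pairing Φ₀ (reduction f g (g' i) * reduction f g (g' j)) (classM f (g k))) •
                    MvPolynomial.X k := by
  have hker := classHom_eq_zero_iff w hw d f hf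
  obtain ⟨N, hN⟩ := classHom_X_pow_eq_zero w hw d f hf g e hg hspan
  let b := Module.Basis.mk (linearIndependent_classSigma f g hker N hN hli)
    (span_classSigma_eq_top f g hker N hN hspan).ge
  have hb : ∀ k, b k = classSigma f g (MvPolynomial.rename Sum.inl (g k)) := fun k =>
    Module.Basis.mk_apply _ _ k
  let bM := Module.Basis.mk hli hspan.ge
  have hbM : ∀ k, reduction f g (b k) = bM k := fun k =>
    (reduction_basis f g b hb k).trans (Module.Basis.mk_apply hli hspan.ge k).symm
  refine ⟨b, hb, ?_, fun Φ hΦ => ?_⟩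
  · obtain ⟨⟨c, hc, hhess⟩, hnd⟩ := hessian_eq_smul_and_nondegenerate w hw d f hf g e hg hli hspan
      0 fun k => he (Fin.zero_le k)
    refine ⟨c, hc, hhess, ?_⟩
    have hgen : GeneratesDual (b.coord 0) := by
      -- The index `0` has the highest degree, so its class spans the socle. The coefficient form
      -- takes the value `1` there, hence induces a nondegenerate form on `M_f`.
      refine generatesDual_of_nondegenerate f g b bM hbM _ (hnd _ ?_)
      rw [← reduction_basis f g b hb, inducedForm_reduction f g b bM hbM]
      rw [Module.Basis.coord_apply, Module.Basis.repr_self, Finsupp.single_eq_same,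
        ← valueHom_apply, map_one]
      exact one_ne_zero
    -- The constant `c⁻¹` becomes a unit of `O_S`, and rescaling by a unit preserves generators.
    have := generatesDual_smul _ hgen
      (Units.map (algebraMap ℂ (Conv (Fin (m + 1)))).toMonoidHom (Units.mk0 c⁻¹ (inv_ne_zero hc)))
    convert this using 1
    ext h
    simp [Algebra.smul_def]
  · obtain ⟨g', hg'⟩ := exists_dual_basis b Φ hΦ
    have hform := inducedForm_reduction f g b bM hbM Φ
    have hmat := smul_multiplicationMatrix_apply f g b g' Φ hg' hb w d hf e hg
    refine ⟨g', hg', inducedForm f g b bM Φ, hform, ?_, fun i j => ⟨hmat i j, ?_⟩⟩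
    · refine Matrix.IsSymm.ext fun i j => ?_
      rw [multiplicationMatrix_apply f g b g' Φ hg', multiplicationMatrix_apply f g b g' Φ hg',
        mul_comm (g' i)]
    -- Multiplying a germ by `u_k` leaves only its value at the origin in the linear part, and that
    -- value is computed by the induced form after reduction.
    · rw [← linearPart_smul, hmat, linearPart_sum]
      refine Finset.sum_congr rfl fun k _ => ?_
      rw [linearPart_smul, linearPart_mul_germ_X, smul_smul, pairing, pairing,
        ← reduction_basis f g b hb, ← map_mul (reduction f g), ← map_mul (reduction f g),
        hform]
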